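/- **Setting.** Let $n_x,n_y,T,N\ge 0$ be integers with $NT\ge 2$, let $\sigma>0$, $\lambda\ge 0$, $\delta\in(0,1]$, and let $\mathbb B(r)$ be the closed Euclidean ball of radius $r$ about $0$ in $\mathbb R^{n_x}$. Let $({\mathbf x}_t)_{t\le T}$ and $({\mathbf v}_t)_{t\le T}$ be random vectors in $\mathbb R^{n_x}$ and $\mathbb R^{n_y}$, and let ${\mathbf y}_t=f^*({\mathbf x}_t)+{\mathbf v}_t$. *Data.* For constants $r_1\ge 0$, $K>0$ and all $r\ge r_1$: $\mathbb P(\exists t\le T:\ {\mathbf x}_t\notin\mathbb B(r))\le K e^{-r^2/\sigma^2}$. *Noise.* Conditionally on ${\mathbf x}_1,\dots,{\mathbf x}_t,{\mathbf v}_1,\dots,{\mathbf v}_{t-1}$, the vector ${\mathbf v}_t$ is $\sigma^2$-sub-Gaussian: for every $w\in\mathbb R^{n_y}$, $\mathbb E[e^{\langle w,{\mathbf v}_t\rangle}\mid {\mathbf x}_{1:t},{\mathbf v}_{1:t-1}]\le e^{\sigma^2\|w\|_2^2/2}$ almost surely. *Hypothesis class.* $(f_\theta)_{\theta\in\mathcal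 F_\theta}$ is a family of measurable functions $\mathbb R^{n_x}\to\mathbb R^{n_y}$ containing $f^*$, and $d$ is a semi-metric (i.e. a pseudo-metric) on $\mathcal F_\theta$. For a constant $r_2\ge 0$, polynomials $p_1,p_2$, and all $r\ge r_2$, ${\mathbf z}\in\mathbb B(r)$, $\theta,\theta'\in\mathcal F_\theta$, $$\|f_\theta({\mathbf z})-f_{\theta'}({\mathbf z})\|_2\le p_1(r)\,d(\theta,\theta'),\qquad \|f_\theta({\mathbf z})-f^*({\mathbf z})\|_2\le p_2(r);$$ and for constants $A>0$ and $\mathsf{dim}\ge 1$ the covering numbers satisfy $\mathcal N(\mathcal F_\theta,d,\varepsilon)\le (A/\varepsilon)^{\mathsf{dim}}$ for all $\varepsilon\in(0,1]$. Put $$\mathsf{cond}=\sup_{\theta\in\mathcal F_\theta}\max_{t\le T}\frac{\sqrt{\mathbb E\|f_\theta({\mathbf x}_t)-f^*({\mathbf x}_t)\|_2^4}}{\mathbb E\|f_\theta({\mathbf x}_t)-f^*({\mathbf x}_t)\|_2^2}\in[0,\infty]\quad(0/0:=0),$$ $$\|g\|_{L_2}^2=\frac1T\sum_{t=1}^T\mathbb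 E\|g({\mathbf x}_t)\|_2^2 .$$ *Estimator.* Let $({\mathbf x}^i_t,{\mathbf y}^i_t)_{t\le T}$, $i=1,\dots,N$, be independent copies of $({\mathbf x}_t,{\mathbf y}_t)_{t\le T}$, let $\Omega$ be a nonnegative regularizer on functions, and let $\hat\theta$ be any minimizer over $\mathcal F_\theta$ of $$\frac1{NT}\sum_{i=1}^N\sum_{t=1}^T\|{\mathbf y}^i_t-f_\theta({\mathbf x}^i_t)\|_2^2+\lambda\,\Omega(f_\theta).$$ **Theorem.** There are constants $C,c,\alpha>0$ depending only on $n_y,r_1,r_2,K,A,p_1,p_2$ (not on $n_x,N,T,\sigma,\mathsf{dim},\lambda,\delta,\Omega$, the distributions, the class or $f^*$ themselves) such that, if $$\frac{N}{\ln(NT)}\ \ge\ c\,(1+|\ln\sigma|)\;\mathsf{cond}^2\,\Big[\mathsf{dim}+\ln\frac1\delta\Big],$$ then, with probability at least $1-\delta$, every such minimizer $\hat\theta$ satisfies $$\|f_{\hat\theta}-f^*\|_{L_2}^2\ \le\ C\,\big((1+|\ln\sigma|)\ln(NT)\big)^{\alpha}\;\sigma^2\,\frac{\mathsf{dim}+\ln(1/\delta)}{NT}\;+\;4\lambda\,\Omega(f^*).$$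 -/

import Mathlib

open MeasureTheory ProbabilityTheory
open scoped ENNReal NNReal

/-- `ℝⁿ` with the Euclidean norm. -/
abbrev Vec (n : ℕ) : Type := EuclideanSpace ℝ (Fin n)

section Defs

variable {Ω₀ Ω Θ : Type*} {nx ny T N : ℕ}

/-- Tail condition on a trajectory `x₁, …, x_T`: for every `r ≥ r₁`, the trajectory fails to stay in
the closed ball `𝔹(r)` of `ℝ^{nx}` with probability at most `K exp (-r² / σ²)`. -/
def TrajectoryTail [MeasurableSpace Ω₀] (P : Measure Ω₀) (X : Fin T → Ω₀ → Vec nx)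
    (σ r₁ K : ℝ) : Prop :=
  ∀ r : ℝ, r₁ ≤ r →
    P {ω | ∃ t, X t ω ∉ Metric.closedBall (0 : Vec nx) r}
      ≤ ENNReal.ofReal (K * Real.exp (-r ^ 2 / σ ^ 2))

/-- The information available just before the noise `v_t` is drawn: the `σ`-algebra generated by
`x₁, …, x_t` and `v₁, …, v_{t-1}`. -/
abbrev noisePast (X : Fin T → Ω₀ → Vec nx) (V : Fin T → Ω₀ → Vec ny) (t : Fin T) :
    MeasurableSpace Ω₀ :=
  (⨆ s : Fin T, ⨆ _ : s ≤ t, MeasurableSpace.comap (X s) inferInstance) ⊔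
    (⨆ s : Fin T, ⨆ _ : s < t, MeasurableSpace.comap (V s) inferInstance)

/-- Conditionally on `x₁, …, x_t` and `v₁, …, v_{t-1}`, the vector `v_t` is sub-Gaussian with
variance proxy `σ²`. -/
def CondSubGaussianNoise [MeasurableSpace Ω₀] (P : Measure Ω₀) (X : Fin T → Ω₀ → Vec nx)
    (V : Fin T → Ω₀ → Vec ny) (σ : ℝ) : Prop :=
  ∀ (t : Fin T) (w : Vec ny),
    Integrable (fun ω => Real.exp (inner ℝ w (V t ω))) P ∧
    P[fun ω => Real.exp (inner ℝ w (V t ω)) | noisePast X V t]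
      ≤ᵐ[P] fun _ => Real.exp (σ ^ 2 * ‖w‖ ^ 2 / 2)

/-- Conditions on the parametric class `(f_θ)` relative to the target `fstar` and the
semi-metric of `Θ`: on balls of radius `r ≥ r₂` the class is Lipschitz in the parameter and stays
at bounded distance from `fstar`, both polynomially in `r`, and the covering numbers
of `Θ` are of order `ε ^ (-dim)`. -/
structure RegularClass [PseudoMetricSpace Θ] (f : Θ → Vec nx → Vec ny) (fstar : Vec nx → Vec ny)
    (r₂ A dim : ℝ) (p₁ p₂ : Polynomial ℝ) : Prop where
  lipschitz : ∀ r : ℝ, r₂ ≤ r → ∀ θ θ' : Θ, ∀ z ∈ Metric.closedBall (0 : Vec nx) r,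
    ‖f θ z - f θ' z‖ ≤ p₁.eval r * dist θ θ'
  bounded : ∀ r : ℝ, r₂ ≤ r → ∀ θ : Θ, ∀ z ∈ Metric.closedBall (0 : Vec nx) r,
    ‖f θ z - fstar z‖ ≤ p₂.eval r
  covering : ∀ ε : ℝ≥0, 0 < ε → ε ≤ 1 →
    ((Metric.coveringNumber ε (Set.univ : Set Θ) : ℕ∞) : ℝ≥0∞)
      ≤ ENNReal.ofReal ((A / ε) ^ dim)

/-- The condition number of the class `(f_θ - fstar)`, with values in `[0, ∞]`:
`sup_θ max_t √(E ‖f_θ(x_t) - fstar(x_t)‖⁴) / E ‖f_θ(x_t) - fstar(x_t)‖²`, with `0 / 0 = 0`. -/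
noncomputable def condNumber [MeasurableSpace Ω₀] (P : Measure Ω₀) (X : Fin T → Ω₀ → Vec nx)
    (f : Θ → Vec nx → Vec ny) (fstar : Vec nx → Vec ny) : ℝ≥0∞ :=
  ⨆ θ : Θ, ⨆ t : Fin T,
    (∫⁻ ω, ‖f θ (X t ω) - fstar (X t ω)‖ₑ ^ 4 ∂P) ^ (1 / 2 : ℝ) /
      ∫⁻ ω, ‖f θ (X t ω) - fstar (X t ω)‖ₑ ^ 2 ∂P

/-- The population error `‖g - h‖²_{L₂} = (1/T) ∑_t E ‖g(x_t) - h(x_t)‖²`. -/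
noncomputable def popErrorSq [MeasurableSpace Ω₀] (P : Measure Ω₀) (X : Fin T → Ω₀ → Vec nx)
    (g h : Vec nx → Vec ny) : ℝ≥0∞ :=
  (∑ t : Fin T, ∫⁻ ω, ‖g (X t ω) - h (X t ω)‖ₑ ^ 2 ∂P) / (T : ℝ≥0∞)

/-- The pairs `(xⁱ, yⁱ)`, `i < N`, are independent copies of the trajectory `(X, Y)`. -/
structure IIDRollouts [MeasurableSpace Ω₀] [MeasurableSpace Ω] (P : Measure Ω₀) (μ : Measure Ω)
    (X : Fin T → Ω₀ → Vec nx) (Y : Fin T → Ω₀ → Vec ny)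
    (x : Fin N → Fin T → Ω → Vec nx) (y : Fin N → Fin T → Ω → Vec ny) : Prop where
  indep : iIndepFun (fun (i : Fin N) (ω : Ω) (t : Fin T) => (x i t ω, y i t ω)) μ
  ident : ∀ i : Fin N, IdentDistrib (fun (ω : Ω) (t : Fin T) => (x i t ω, y i t ω))
    (fun (ω : Ω₀) (t : Fin T) => (X t ω, Y t ω)) μ P

/-- The regularized empirical risk of a predictor `g` on given data. -/
noncomputable def regEmpRisk (lam : ℝ) (Reg : (Vec nx → Vec ny) → ℝ)
    (x : Fin N → Fin T → Vec nx) (y : Fin N → Fin T → Vec ny) (g : Vec nx → Vec ny) : ℝ :=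
  1 / ((N : ℝ) * T) * ∑ i : Fin N, ∑ t : Fin T, ‖y i t - g (x i t)‖ ^ 2 + lam * Reg g

/-- `θ` is a global minimizer over the class of the regularized empirical risk. -/
def IsRegERM (lam : ℝ) (Reg : (Vec nx → Vec ny) → ℝ) (f : Θ → Vec nx → Vec ny)
    (x : Fin N → Fin T → Vec nx) (y : Fin N → Fin T → Vec ny) (θ : Θ) : Prop :=
  ∀ θ' : Θ, regEmpRisk lam Reg x y (f θ) ≤ regEmpRisk lam Reg x y (f θ')

end Defs

/-! Write `g = f_θ̂ - f*` and `n = NT`. Comparing the risks of `θ̂` and `f*` gives the basic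
inequality `∑ ‖g‖² ≤ 2 ∑ ⟨v, g⟩ + n λ Reg f*` on the sample. The noise term is controlled in offset
form. For a fixed `G`, the exponential of `∑ ⟨G(x_t), v_t⟩ - σ² ‖G(x_t)‖² / 2` has mean at most one
(`lintegral_exp_sum_inner_noise_le_one`), because `G(x_t)` is known before `v_t` is drawn. Taking `G
= (f_θ - f*) / (8σ²)` bounds `∑ ⟨v, g⟩` by `∑ ‖g‖² / 16 + 8σ² u` with probability `1 - e^{-u}`. The
quadratic part is absorbed on the left, so no localization is needed and the rate is `σ² u / n`.

Passing from the empirical to the population error needs only a lower bound. The squares are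
nonnegative and `cond` bounds their second moment by the squared mean, so a one-sided Bernstein
inequality (`measure_sum_rollouts_le_half_mean`) yields at least half the mean except with
probability `exp (-N / (8 cond²))`. Whole trajectories are the independent units, and Cauchy–Schwarz
carries `cond` to sums over `t` (`HypercontractiveWith.sum`); no mixing in time is used.

Both bounds are taken on a finite net of the class. Up to small probability the data stay in a ball
of radius polynomial in `n` and `σ`, and there the class is Lipschitz. A resolution `ε = e^{-O(L)}`
with `L = (1 + |log σ|) log n` therefore makes the discretization error at most of order `σ² / n`,
and the log-cardinality of the net is only `O(dim · L)`. This is the sole source of logarithms, so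
`α = 1` suffices. Off the ball, `cond` again shows that the mean carried by a rare event is
negligible (`HypercontractiveWith.setIntegral_le`). Four exceptional events of probability `δ/4`
remain; none depends on `θ̂`, so all minimizers are treated at once. -/

theorem exists_finite_range_tendsto {Ω₀ : Type*} [MeasurableSpace Ω₀] {n : ℕ} {w : Ω₀ → Vec n}
    (hw : Measurable w) :
    ∃ W : ℕ → Ω₀ → Vec n, (∀ k, Measurable (W k)) ∧ (∀ k, (Set.range (W k)).Finite) ∧
      ∀ ω, Filter.Tendsto (fun k => W k ω) Filter.atTop (nhds (w ω)) :=
  ⟨fun k => SimpleFunc.approxOn w hw Set.univ 0 (Set.mem_univ _) k,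
    fun k => SimpleFunc.measurable _, fun k => SimpleFunc.finite_range _,
    fun ω => SimpleFunc.tendsto_approxOn hw (Set.mem_univ _) (by simp)⟩

/-! ### Conditional exponential moments in random directions -/

section Conditional

variable {Ω₀ : Type*} {m m₀ : MeasurableSpace Ω₀} {P : Measure Ω₀}

/-- The conditional bound is a domination between two measures restricted to `m`: the one with
density `h`, and `c • P`. Integrating `Z` against both requires no integrability of `Z`. -/
theorem lintegral_mul_le_of_condExp_le [IsFiniteMeasure P] (hm : m ≤ m₀) {h : Ω₀ → ℝ}
    (hi : Integrable h P) (h0 : 0 ≤ h) {c : ℝ} (hc : P[h | m] ≤ᵐ[P] fun _ => c)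
    {Z : Ω₀ → ℝ≥0∞} (hZ : Measurable[m] Z) :
    ∫⁻ ω, Z ω * ENNReal.ofReal (h ω) ∂P ≤ ENNReal.ofReal c * ∫⁻ ω, Z ω ∂P := by
  have hle : (P.withDensity fun ω => ENNReal.ofReal (h ω)).trim hm
      ≤ ENNReal.ofReal c • P.trim hm := by
    refine (@Measure.le_iff _ m _ _).2 fun s hs => ?_
    rw [trim_measurableSet_eq hm hs, Measure.smul_apply, trim_measurableSet_eq hm hs,
      withDensity_apply _ (hm s hs),
      ← ofReal_integral_eq_lintegral_ofReal hi.integrableOn (Filter.Eventually.of_forall h0),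
      ← setIntegral_condExp hm hi hs]
    calc ENNReal.ofReal (∫ ω in s, (P[h | m]) ω ∂P)
        ≤ ENNReal.ofReal (∫ ω in s, c ∂P) := by
          refine ENNReal.ofReal_le_ofReal (integral_mono_ae integrable_condExp.integrableOn
            (integrable_const c) (ae_restrict_of_ae hc))
      _ = ENNReal.ofReal c • P s := by
          rw [setIntegral_const, smul_eq_mul, smul_eq_mul, ENNReal.ofReal_mul measureReal_nonneg,
            mul_comm, ofReal_measureReal]
  calc ∫⁻ ω, Z ω * ENNReal.ofReal (h ω) ∂P
      = ∫⁻ ω, Z ω ∂(P.withDensity fun ω => ENNReal.ofReal (h ω)) := by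
        rw [lintegral_withDensity_eq_lintegral_mul₀ hi.aemeasurable.ennreal_ofReal
          (hZ.mono hm le_rfl).aemeasurable]
        simp [mul_comm]
    _ = @lintegral _ m ((P.withDensity fun ω => ENNReal.ofReal (h ω)).trim hm) Z :=
        (lintegral_trim hm hZ).symm
    _ ≤ @lintegral _ m (ENNReal.ofReal c • P.trim hm) Z := lintegral_mono' hle le_rfl
    _ = ENNReal.ofReal c * ∫⁻ ω, Z ω ∂P := by
        rw [lintegral_smul_measure, lintegral_trim hm hZ, smul_eq_mul]

/-- If `w` has finite range, it is constant on finitely many `m`-measurable pieces, where `hfix`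
applies. The general case follows by approximation and Fatou's lemma. Positivity of `Φ` excludes the
indeterminate limit `∞ · 0`, since `Z` may be infinite. -/
theorem lintegral_mul_le_of_forall_direction (hm : m ≤ m₀) {n : ℕ} {V : Ω₀ → Vec n}
    (hV : Measurable V) {Φ : Vec n → Vec n → ℝ≥0∞}
    (hΦc : Continuous fun q : Vec n × Vec n => Φ q.1 q.2) (hpos : ∀ a v, Φ a v ≠ 0)
    {Z : Ω₀ → ℝ≥0∞} (hZ' : Measurable Z)
    (hfix : ∀ (a : Vec n) (s : Set Ω₀), MeasurableSet[m] s →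
      ∫⁻ ω in s, Z ω * Φ a (V ω) ∂P ≤ ∫⁻ ω in s, Z ω ∂P)
    {w : Ω₀ → Vec n} (hw : Measurable[m] w) :
    ∫⁻ ω, Z ω * Φ (w ω) (V ω) ∂P ≤ ∫⁻ ω, Z ω ∂P := by
  obtain ⟨W, hWm', hWfin, hWlim⟩ := @exists_finite_range_tendsto Ω₀ m n w hw
  have hWm : ∀ k, Measurable (W k) := fun k => (hWm' k).mono hm le_rfl
  have hstep : ∀ k, ∫⁻ ω, Z ω * Φ (W k ω) (V ω) ∂P ≤ ∫⁻ ω, Z ω ∂P := by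
    intro k
    have hdecomp : ∀ F : Ω₀ → ℝ≥0∞,
        ∫⁻ ω, F ω ∂P = ∑ a ∈ (hWfin k).toFinset, ∫⁻ ω in W k ⁻¹' {a}, F ω ∂P := by
      intro F
      have hU : (⋃ a ∈ (hWfin k).toFinset, W k ⁻¹' {a}) = Set.univ := by
        ext ω; simp
      rw [← lintegral_biUnion_finset _ _ F, hU, Measure.restrict_univ]
      · intro a _ b _ hab
        exact Set.disjoint_left.2 fun ω h1 h2 => hab (by simp_all)
      · intro a _
        exact hWm k (measurableSet_singleton a)
    rw [hdecomp, hdecomp Z]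
    refine Finset.sum_le_sum fun a _ => ?_
    have hs : MeasurableSet[m] (W k ⁻¹' {a}) := hWm' k (measurableSet_singleton a)
    rw [setLIntegral_congr_fun (g := fun ω => Z ω * Φ a (V ω)) (hm _ hs)
      (fun ω hω => by
        have : W k ω = a := hω
        simp [this])]
    exact hfix a _ hs
  have hlim : ∀ ω, Filter.Tendsto (fun k => Z ω * Φ (W k ω) (V ω)) Filter.atTop
      (nhds (Z ω * Φ (w ω) (V ω))) := fun ω =>
    ENNReal.Tendsto.const_mul ((hΦc.tendsto (w ω, V ω)).comp
      ((hWlim ω).prodMk_nhds tendsto_const_nhds)) (Or.inl (hpos _ _))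
  have hmeas : ∀ k, Measurable fun ω => Z ω * Φ (W k ω) (V ω) := fun k =>
    hZ'.mul (hΦc.measurable.comp ((hWm k).prodMk hV))
  calc ∫⁻ ω, Z ω * Φ (w ω) (V ω) ∂P
      ≤ ∫⁻ ω, Filter.liminf (fun k => Z ω * Φ (W k ω) (V ω)) Filter.atTop ∂P := by
        exact lintegral_mono fun ω => (hlim ω).liminf_eq.ge
    _ ≤ Filter.liminf (fun k => ∫⁻ ω, Z ω * Φ (W k ω) (V ω) ∂P) Filter.atTop := by
        exact lintegral_liminf_le hmeas
    _ ≤ ∫⁻ ω, Z ω ∂P := Filter.liminf_le_of_frequently_le' (Filter.Frequently.of_forall hstep)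

/-- A conditional sub-Gaussian bound for all fixed directions gives one for a random direction
that is measurable with respect to the conditioning `σ`-algebra. -/
theorem lintegral_mul_exp_le_of_condSubGaussian [IsFiniteMeasure P] (hm : m ≤ m₀) {n : ℕ} {σ : ℝ}
    {V : Ω₀ → Vec n} (hV : Measurable V)
    (hsub : ∀ w : Vec n, Integrable (fun ω => Real.exp (inner ℝ w (V ω))) P ∧
      P[fun ω => Real.exp (inner ℝ w (V ω)) | m]
        ≤ᵐ[P] fun _ => Real.exp (σ ^ 2 * ‖w‖ ^ 2 / 2))
    {Z : Ω₀ → ℝ≥0∞} (hZ : Measurable[m] Z) {w : Ω₀ → Vec n} (hw : Measurable[m] w) :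
    ∫⁻ ω, Z ω * ENNReal.ofReal (Real.exp (inner ℝ (w ω) (V ω) - σ ^ 2 * ‖w ω‖ ^ 2 / 2)) ∂P
      ≤ ∫⁻ ω, Z ω ∂P := by
  set Φ : Vec n → Vec n → ℝ≥0∞ := fun a v =>
    ENNReal.ofReal (Real.exp (inner ℝ a v - σ ^ 2 * ‖a‖ ^ 2 / 2)) with hΦ
  have hΦc : Continuous fun q : Vec n × Vec n => Φ q.1 q.2 := by
    refine ENNReal.continuous_ofReal.comp ?_
    fun_prop
  have hZ' : Measurable Z := hZ.mono hm le_rfl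
  refine lintegral_mul_le_of_forall_direction hm hV hΦc (fun a v => ?_) hZ' ?_ hw
  · simp only [hΦ, ne_eq, ENNReal.ofReal_eq_zero, not_le]
    exact Real.exp_pos _
  have hfix : ∀ (a : Vec n) (s : Set Ω₀), MeasurableSet[m] s →
      ∫⁻ ω in s, Z ω * Φ a (V ω) ∂P ≤ ∫⁻ ω in s, Z ω ∂P := by
    intro a s hs
    have key := lintegral_mul_le_of_condExp_le hm (hsub a).1 (fun ω => (Real.exp_pos _).le)
      (hsub a).2 (hZ.indicator hs)
    have hsplit : ∀ ω, Z ω * Φ a (V ω) = ENNReal.ofReal (Real.exp (-(σ ^ 2 * ‖a‖ ^ 2 / 2))) *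
        (Z ω * ENNReal.ofReal (Real.exp (inner ℝ a (V ω)))) := by
      intro ω
      simp only [hΦ]
      rw [sub_eq_add_neg, Real.exp_add, ENNReal.ofReal_mul (Real.exp_pos _).le]
      ring
    have hmeas : Measurable fun ω => Z ω * ENNReal.ofReal (Real.exp (inner ℝ a (V ω))) := by
      fun_prop
    simp_rw [hsplit]
    rw [lintegral_const_mul _ hmeas, ← lintegral_indicator (hm s hs),
      ← lintegral_indicator (hm s hs)]
    have : (s.indicator fun ω => Z ω * ENNReal.ofReal (Real.exp (inner ℝ a (V ω))))
        = fun ω => s.indicator Z ω * ENNReal.ofReal (Real.exp (inner ℝ a (V ω))) := by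
      ext ω; by_cases h : ω ∈ s <;> simp [h]
    rw [this]
    calc _ ≤ ENNReal.ofReal (Real.exp (-(σ ^ 2 * ‖a‖ ^ 2 / 2))) *
          (ENNReal.ofReal (Real.exp (σ ^ 2 * ‖a‖ ^ 2 / 2)) * ∫⁻ ω, s.indicator Z ω ∂P) := by
          gcongr
      _ = ∫⁻ ω, s.indicator Z ω ∂P := by
          rw [← mul_assoc, ← ENNReal.ofReal_mul (Real.exp_pos _).le, ← Real.exp_add]
          simp
  exact hfix

end Conditional

/-! ### Supermartingale and tail bounds for the noise -/

section Noise

variable {Ω₀ : Type*} {nx ny T : ℕ}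

theorem measurable_ofReal_exp_sum {Ω₀ : Type*} [MeasurableSpace Ω₀] {X : Fin T → Ω₀ → Vec nx}
    {V : Fin T → Ω₀ → Vec ny} {G : Vec nx → Vec ny} (hG : Measurable G) (σ : ℝ)
    (S : Finset (Fin T)) (hX : ∀ s ∈ S, Measurable (X s)) (hV : ∀ s ∈ S, Measurable (V s)) :
    Measurable fun ω => ENNReal.ofReal (Real.exp (∑ s ∈ S,
      (inner ℝ (G (X s ω)) (V s ω) - σ ^ 2 * ‖G (X s ω)‖ ^ 2 / 2))) := by
  refine ENNReal.measurable_ofReal.comp (Real.measurable_exp.comp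
    (Finset.measurable_fun_sum _ fun s hs => ?_))
  have h1 := hG.comp (hX s hs)
  have h2 := hV s hs
  exact (h1.inner h2).sub (((h1.norm.pow_const 2).const_mul _).div_const _)

theorem measurable_noisePast_data {X : Fin T → Ω₀ → Vec nx}
    {V : Fin T → Ω₀ → Vec ny} {s t : Fin T} (h : s ≤ t) : Measurable[noisePast X V t] (X s) :=
  Measurable.of_comap_le <| le_trans
    (le_iSup₂ (f := fun s (_ : s ≤ t) => MeasurableSpace.comap (X s) inferInstance) s h)
    le_sup_left

theorem measurable_noisePast_noise {X : Fin T → Ω₀ → Vec nx}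
    {V : Fin T → Ω₀ → Vec ny} {s t : Fin T} (h : s < t) :
    Measurable[noisePast X V t] (V s) :=
  Measurable.of_comap_le <| le_trans
    (le_iSup₂ (f := fun s (_ : s < t) => MeasurableSpace.comap (V s) inferInstance) s h)
    le_sup_right

variable [m₀ : MeasurableSpace Ω₀] {P : Measure Ω₀} [IsProbabilityMeasure P]
  {X : Fin T → Ω₀ → Vec nx} {V : Fin T → Ω₀ → Vec ny} {σ : ℝ}

theorem noisePast_le (hX : ∀ t, Measurable (X t)) (hV : ∀ t, Measurable (V t)) (t : Fin T) :
    noisePast X V t ≤ m₀ :=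
  sup_le (iSup₂_le fun s _ => (hX s).comap_le) (iSup₂_le fun s _ => (hV s).comap_le)

/-- The exponential supermartingale of the noise in directions predictable from the data. -/
theorem lintegral_exp_sum_inner_noise_le_one (hX : ∀ t, Measurable (X t))
    (hV : ∀ t, Measurable (V t)) (hsub : CondSubGaussianNoise P X V σ)
    {G : Vec nx → Vec ny} (hG : Measurable G) :
    ∫⁻ ω, ENNReal.ofReal (Real.exp (∑ t,
      (inner ℝ (G (X t ω)) (V t ω) - σ ^ 2 * ‖G (X t ω)‖ ^ 2 / 2))) ∂P ≤ 1 := by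
  have key : ∀ k : ℕ, k ≤ T → ∫⁻ ω, ENNReal.ofReal (Real.exp
      (∑ t ∈ Finset.univ.filter (fun t : Fin T => t.val < k),
        (inner ℝ (G (X t ω)) (V t ω) - σ ^ 2 * ‖G (X t ω)‖ ^ 2 / 2))) ∂P ≤ 1 := by
    intro k
    induction k with
    | zero => intro _; simp
    | succ k ih =>
      intro hk
      have hins : Finset.univ.filter (fun t : Fin T => t.val < k + 1)
          = insert ⟨k, hk⟩ (Finset.univ.filter (fun t : Fin T => t.val < k)) := by
        ext t
        simp only [Finset.mem_filter, Finset.mem_univ, true_and, Finset.mem_insert, Fin.ext_iff]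
        omega
      have hlt : ∀ s ∈ Finset.univ.filter (fun t : Fin T => t.val < k), s < ⟨k, hk⟩ := by
        intro s hs
        simpa [Fin.lt_def] using hs
      -- The last factor is integrated out given the past: the earlier factors and the direction `G
      -- (X t)` are both measurable with respect to `noisePast X V t`, which contains `X t` but not
      -- `V t`.
      refine le_trans (le_of_eq_of_le (lintegral_congr fun ω => ?_)
        (lintegral_mul_exp_le_of_condSubGaussian (noisePast_le hX hV ⟨k, hk⟩) (hV ⟨k, hk⟩)
          (hsub ⟨k, hk⟩)
          (@measurable_ofReal_exp_sum _ _ _ _ (noisePast X V ⟨k, hk⟩) X V G hG σ _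
            (fun s hs => measurable_noisePast_data (hlt s hs).le)
            (fun s hs => measurable_noisePast_noise (hlt s hs)))
          (hG.comp (measurable_noisePast_data (V := V) le_rfl)))) (ih (by omega))
      rw [hins, Finset.sum_insert (by simp), add_comm, Real.exp_add,
        ENNReal.ofReal_mul (Real.exp_pos _).le]
      rfl
  have := key T le_rfl
  simpa using this

theorem measure_le_inner_noise (hX : ∀ t, Measurable (X t))
    (hV : ∀ t, Measurable (V t)) (hsub : CondSubGaussianNoise P X V σ) (t : Fin T) (w : Vec ny)
    (a : ℝ) :
    P {ω | a ≤ inner ℝ w (V t ω)}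
      ≤ ENNReal.ofReal (Real.exp (σ ^ 2 * ‖w‖ ^ 2 / 2 - a)) := by
  have h1 := lintegral_mul_le_of_condExp_le (noisePast_le hX hV t) (hsub t w).1
    (fun ω => (Real.exp_pos _).le) (hsub t w).2 (Z := fun _ => 1) measurable_const
  simp only [one_mul, lintegral_const, measure_univ, mul_one] at h1
  have h2 : P {ω | a ≤ inner ℝ w (V t ω)}
      ≤ (∫⁻ ω, ENNReal.ofReal (Real.exp (inner ℝ w (V t ω))) ∂P)
        / ENNReal.ofReal (Real.exp a) := by
    refine le_trans (measure_mono fun ω hω => ?_) (meas_ge_le_lintegral_div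
      (hsub t w).1.aemeasurable.ennreal_ofReal ?_ ENNReal.ofReal_ne_top)
    · exact ENNReal.ofReal_le_ofReal (Real.exp_le_exp.2 hω)
    · simp [Real.exp_pos]
  refine h2.trans ?_
  rw [Real.exp_sub, ENNReal.ofReal_div_of_pos (Real.exp_pos _)]
  gcongr

theorem measure_norm_noise_ge (hσ : 0 < σ) (hX : ∀ t, Measurable (X t))
    (hV : ∀ t, Measurable (V t)) (hsub : CondSubGaussianNoise P X V σ) (t : Fin T) (a : ℝ) :
    P {ω | σ * ny * a < ‖V t ω‖} ≤ ENNReal.ofReal (2 * ny * Real.exp (1 / 2 - a)) := by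
  classical
  -- Scaling by `σ⁻¹` makes every coordinate exponent equal to `1/2`; the Euclidean norm is then
  -- bounded by the `ℓ¹` norm.
  let e : Fin ny → Vec ny := fun j => σ⁻¹ • EuclideanSpace.single j (1 : ℝ)
  have he : ∀ j, σ ^ 2 * ‖e j‖ ^ 2 / 2 = 1 / 2 := by
    intro j
    simp only [e, norm_smul, norm_inv, Real.norm_eq_abs, abs_of_pos hσ, PiLp.norm_single,
      norm_one, mul_one]
    field_simp
  have hin : ∀ j (v : Vec ny), inner ℝ (e j) v = σ⁻¹ * v j := by
    intro j v
    rw [inner_smul_left, EuclideanSpace.inner_single_left]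
    simp
  have hsubset : {ω | σ * ny * a < ‖V t ω‖} ⊆ ⋃ j : Fin ny,
      ({ω | a ≤ inner ℝ (e j) (V t ω)} ∪ {ω | a ≤ inner ℝ (-e j) (V t ω)}) := by
    intro ω hω
    by_contra hcon
    simp only [Set.mem_iUnion, Set.mem_union, Set.mem_ofPred_eq, not_exists, not_or, not_le,
      inner_neg_left, hin] at hcon
    have hj : ∀ j, |V t ω j| ≤ σ * a := by
      intro j
      obtain ⟨h1, h2⟩ := hcon j
      rw [inv_mul_lt_iff₀ hσ] at h1
      rw [← mul_neg, inv_mul_lt_iff₀ hσ] at h2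
      exact abs_le.2 ⟨by linarith, by linarith⟩
    have hn : ‖V t ω‖ ≤ ∑ j, |V t ω j| := by
      rw [EuclideanSpace.norm_eq]
      refine Real.sqrt_le_iff.2 ⟨Finset.sum_nonneg fun _ _ => abs_nonneg _, ?_⟩
      exact Finset.sum_sq_le_sq_sum_of_nonneg fun _ _ => abs_nonneg _
    have : ∑ j, |V t ω j| ≤ ny * (σ * a) := by
      simpa using Finset.sum_le_sum fun j (_ : j ∈ Finset.univ) => hj j
    have hω' : σ * ny * a < ‖V t ω‖ := hω
    linarith
  refine (measure_mono hsubset).trans ((measure_iUnion_le _).trans ?_)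
  rw [tsum_fintype]
  calc ∑ j, P ({ω | a ≤ inner ℝ (e j) (V t ω)} ∪ {ω | a ≤ inner ℝ (-e j) (V t ω)})
      ≤ ∑ _j : Fin ny, ENNReal.ofReal (2 * Real.exp (1 / 2 - a)) := by
        refine Finset.sum_le_sum fun j _ => (measure_union_le _ _).trans ?_
        have h1 := measure_le_inner_noise hX hV hsub t (e j) a
        have h2 := measure_le_inner_noise hX hV hsub t (-e j) a
        rw [norm_neg, he] at h2
        rw [he] at h1
        rw [two_mul, ENNReal.ofReal_add (Real.exp_pos _).le (Real.exp_pos _).le]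
        exact add_le_add h1 h2
    _ = ENNReal.ofReal (2 * ny * Real.exp (1 / 2 - a)) := by
        rw [Finset.sum_const, Finset.card_univ, Fintype.card_fin, nsmul_eq_mul,
          ← ENNReal.ofReal_natCast, ← ENNReal.ofReal_mul (by positivity)]
        congr 1; ring

end Noise

/-! ### Chernoff and one-sided Bernstein bounds for independent copies -/

section Rollouts

theorem lintegral_prod_rollouts {Ω₀ Ω E : Type*} [MeasurableSpace Ω₀] [MeasurableSpace Ω]
    [MeasurableSpace E] {P : Measure Ω₀} {μ : Measure Ω} {N : ℕ} {Z : Fin N → Ω → E} {Z₀ : Ω₀ → E}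
    (hind : iIndepFun Z μ) (hid : ∀ i, IdentDistrib (Z i) Z₀ μ P) (hZ : ∀ i, Measurable (Z i))
    {F : E → ℝ≥0∞} (hF : Measurable F) :
    ∫⁻ ω, ∏ i, F (Z i ω) ∂μ = (∫⁻ ω, F (Z₀ ω) ∂P) ^ N := by
  have h := lintegral_prod_eq_prod_lintegral_of_indepFun Finset.univ (fun i ω => F (Z i ω))
    (hind.comp (fun _ => F) fun _ => hF) (fun i => hF.comp (hZ i))
  refine h.trans ((Finset.prod_congr rfl fun i _ => ((hid i).comp hF).lintegral_eq).trans ?_)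
  simp

/-- Chernoff bound for the sum of a function over independent copies. -/
theorem measure_sum_rollouts_ge {Ω₀ Ω E : Type*} [MeasurableSpace Ω₀] [MeasurableSpace Ω]
    [MeasurableSpace E] {P : Measure Ω₀} {μ : Measure Ω} {N : ℕ} {Z : Fin N → Ω → E} {Z₀ : Ω₀ → E}
    (hind : iIndepFun Z μ) (hid : ∀ i, IdentDistrib (Z i) Z₀ μ P) (hZ : ∀ i, Measurable (Z i))
    {F : E → ℝ} (hF : Measurable F) {b : ℝ}
    (hb : ∫⁻ ω, ENNReal.ofReal (Real.exp (F (Z₀ ω))) ∂P ≤ ENNReal.ofReal (Real.exp b)) (u : ℝ) :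
    μ {ω | u ≤ ∑ i, F (Z i ω)} ≤ ENNReal.ofReal (Real.exp (N * b - u)) := by
  have hF' : Measurable fun z => ENNReal.ofReal (Real.exp (F z)) := by fun_prop
  have h := lintegral_prod_rollouts hind hid hZ hF'
  have hprod : ∀ ω, ∏ i, ENNReal.ofReal (Real.exp (F (Z i ω)))
      = ENNReal.ofReal (Real.exp (∑ i, F (Z i ω))) := by
    intro ω
    rw [Real.exp_sum, ENNReal.ofReal_prod_of_nonneg fun _ _ => (Real.exp_pos _).le]
  simp_rw [hprod] at h
  have h2 : μ {ω | u ≤ ∑ i, F (Z i ω)}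
      ≤ (∫⁻ ω, ENNReal.ofReal (Real.exp (∑ i, F (Z i ω))) ∂μ)
        / ENNReal.ofReal (Real.exp u) := by
    refine le_trans (measure_mono fun ω hω => ?_) (meas_ge_le_lintegral_div
      (Measurable.aemeasurable (by fun_prop)) ?_ ENNReal.ofReal_ne_top)
    · exact ENNReal.ofReal_le_ofReal (Real.exp_le_exp.2 hω)
    · simp [Real.exp_pos]
  refine h2.trans ?_
  rw [h, Real.exp_sub, ENNReal.ofReal_div_of_pos (Real.exp_pos _), Real.exp_nat_mul,
    ENNReal.ofReal_pow (Real.exp_pos _).le]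
  gcongr

/-- One-sided Bernstein bound for sums of nonnegative functions of independent copies. -/
theorem measure_sum_rollouts_le_half_mean {Ω₀ Ω E : Type*} [MeasurableSpace Ω₀] [MeasurableSpace Ω]
    [MeasurableSpace E] {P : Measure Ω₀} [IsProbabilityMeasure P] {μ : Measure Ω} {N : ℕ}
    {Z : Fin N → Ω → E} {Z₀ : Ω₀ → E}
    (hind : iIndepFun Z μ) (hid : ∀ i, IdentDistrib (Z i) Z₀ μ P) (hZ : ∀ i, Measurable (Z i))
    {F : E → ℝ} (hF : Measurable F) (hF0 : ∀ z, 0 ≤ F z)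
    (hi : Integrable (fun ω => F (Z₀ ω)) P) (hi2 : Integrable (fun ω => F (Z₀ ω) ^ 2) P)
    {M κ : ℝ} (hM : ∫ ω, F (Z₀ ω) ∂P = M) (hM0 : 0 < M) (hκ : 0 < κ)
    (h2 : ∫ ω, F (Z₀ ω) ^ 2 ∂P ≤ κ ^ 2 * M ^ 2) :
    μ {ω | ∑ i, F (Z i ω) ≤ N * M / 2} ≤ ENNReal.ofReal (Real.exp (-(N / (8 * κ ^ 2)))) := by
  -- This value minimizes the exponent `N (-s M / 2 + s² κ² M² / 2)`, with minimum `-N / (8κ²)`.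
  set s : ℝ := 1 / (2 * κ ^ 2 * M) with hs
  have hs0 : 0 < s := by positivity
  set b : ℝ := -s * M + s ^ 2 * (κ ^ 2 * M ^ 2) / 2 with hb
  -- This follows from `1 + x + x²/2 ≤ e^x` and `(1 + x + x²/2)(1 - x + x²/2) = 1 + x⁴/4`.
  have hquad : ∀ x : ℝ, 0 ≤ x → Real.exp (-x) ≤ 1 - x + x ^ 2 / 2 := by
    intro x hx
    have h3 := Real.quadratic_le_exp_of_nonneg hx
    rw [Real.exp_neg, inv_le_iff_one_le_mul₀ (Real.exp_pos x)]
    have h4 : 0 ≤ 1 - x + x ^ 2 / 2 := by nlinarith [sq_nonneg (x - 1)]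
    nlinarith [mul_le_mul_of_nonneg_left h3 h4, sq_nonneg (x ^ 2)]
  have hint : Integrable (fun ω => 1 - s * F (Z₀ ω) + s ^ 2 / 2 * F (Z₀ ω) ^ 2) P :=
    ((integrable_const 1).sub (hi.const_mul s)).add (hi2.const_mul _)
  have hlap : ∫⁻ ω, ENNReal.ofReal (Real.exp (-s * F (Z₀ ω))) ∂P
      ≤ ENNReal.ofReal (Real.exp b) := by
    calc _ ≤ ∫⁻ ω, ENNReal.ofReal (1 - s * F (Z₀ ω) + s ^ 2 / 2 * F (Z₀ ω) ^ 2) ∂P := by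
          refine lintegral_mono fun ω => ENNReal.ofReal_le_ofReal ?_
          have := hquad _ (mul_nonneg hs0.le (hF0 (Z₀ ω)))
          rw [neg_mul]
          linarith
      _ = ENNReal.ofReal (∫ ω, (1 - s * F (Z₀ ω) + s ^ 2 / 2 * F (Z₀ ω) ^ 2) ∂P) := by
          refine (ofReal_integral_eq_lintegral_ofReal hint
            (Filter.Eventually.of_forall fun ω => ?_)).symm
          have := hquad _ (mul_nonneg hs0.le (hF0 (Z₀ ω)))
          have := Real.exp_pos (-(s * F (Z₀ ω)))
          simp only [Pi.zero_apply]
          linarith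
      _ ≤ ENNReal.ofReal (Real.exp b) := by
          refine ENNReal.ofReal_le_ofReal ?_
          rw [integral_add (f := fun ω => 1 - s * F (Z₀ ω)) ((integrable_const 1).sub (hi.const_mul s))
              (hi2.const_mul _), integral_sub (integrable_const 1) (hi.const_mul s), integral_const_mul,
            integral_const_mul, hM]
          simp only [integral_const, probReal_univ, smul_eq_mul, mul_one]
          have h5 := Real.add_one_le_exp b
          have h6 := mul_le_mul_of_nonneg_left h2 (by positivity : (0 : ℝ) ≤ s ^ 2 / 2)
          rw [hb] at h5 ⊢
          linarith
  have h := measure_sum_rollouts_ge hind hid hZ (hF.const_mul (-s)) hlap (-s * (N * M / 2))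
  refine (measure_mono fun ω hω => ?_).trans (h.trans_eq ?_)
  · simp only [Set.mem_ofPred_eq, ← Finset.mul_sum] at hω ⊢
    exact mul_le_mul_of_nonpos_left hω (by linarith)
  · congr 2
    rw [hb, hs]
    field_simp
    ring

end Rollouts

/-! ### Finite moments and consequences of the condition number -/

section Moments

theorem Polynomial.exists_abs_eval_le (p : Polynomial ℝ) :
    ∃ (B : ℝ) (d : ℕ), 1 ≤ B ∧ ∀ r : ℝ, 0 ≤ r → |p.eval r| ≤ B * (1 + r) ^ d := by
  refine ⟨1 + ∑ i ∈ Finset.range (p.natDegree + 1), |p.coeff i|, p.natDegree,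
    le_add_of_nonneg_right (Finset.sum_nonneg fun _ _ => abs_nonneg _), fun r hr => ?_⟩
  rw [Polynomial.eval_eq_sum_range]
  calc |∑ i ∈ Finset.range (p.natDegree + 1), p.coeff i * r ^ i|
      ≤ ∑ i ∈ Finset.range (p.natDegree + 1), |p.coeff i| * (1 + r) ^ p.natDegree := by
        refine (Finset.abs_sum_le_sum_abs _ _).trans (Finset.sum_le_sum fun i hi => ?_)
        rw [abs_mul, abs_pow, abs_of_nonneg hr]
        refine mul_le_mul_of_nonneg_left ?_ (abs_nonneg _)
        calc r ^ i ≤ (1 + r) ^ i := by gcongr; linarith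
          _ ≤ _ := pow_le_pow_right₀ (by linarith) (by simpa [Nat.lt_succ_iff] using hi)
    _ ≤ _ := by
        rw [← Finset.sum_mul]
        have : 0 ≤ (1 + r) ^ p.natDegree := by positivity
        gcongr
        linarith

variable {Ω₀ : Type*} [MeasurableSpace Ω₀] {P : Measure Ω₀} {nx ny T : ℕ}

theorem summable_pow_mul_exp_neg_sq {σ : ℝ} (hσ : 0 < σ) {R : ℝ} (hR : 0 ≤ R) (d : ℕ) :
    Summable fun k : ℕ => (2 + R + k) ^ d * Real.exp (-(R + k) ^ 2 / σ ^ 2) := by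
  have h := Real.summable_pow_mul_exp_neg_nat_mul d (r := 1) one_pos
  have h1 := ((summable_nat_add_iff 1).2 h).mul_left ((2 + R) ^ d * Real.exp (σ ^ 2 / 4 + 1))
  refine Summable.of_nonneg_of_le (fun k => by positivity) (fun k => ?_) h1
  have e1 : (2 + R + k : ℝ) ^ d ≤ (2 + R) ^ d * ((k + 1 : ℕ) : ℝ) ^ d := by
    rw [← mul_pow]
    have : (0 : ℝ) ≤ k := k.cast_nonneg
    refine pow_le_pow_left₀ (by positivity) ?_ d
    push_cast
    nlinarith
  have e2 : Real.exp (-(R + k) ^ 2 / σ ^ 2)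
      ≤ Real.exp (σ ^ 2 / 4 + 1) * Real.exp (-1 * ((k + 1 : ℕ) : ℝ)) := by
    rw [← Real.exp_add]
    refine Real.exp_le_exp.2 ?_
    push_cast
    rw [div_le_iff₀ (by positivity)]
    have : (0 : ℝ) ≤ k := k.cast_nonneg
    -- Completing the square gives `-(R + k)² / σ² ≤ σ² / 4 - (R + k)`.
    nlinarith [sq_nonneg (R + k - σ ^ 2 / 2), mul_nonneg hR (sq_nonneg σ)]
  calc _ ≤ ((2 + R) ^ d * ((k + 1 : ℕ) : ℝ) ^ d) *
        (Real.exp (σ ^ 2 / 4 + 1) * Real.exp (-1 * ((k + 1 : ℕ) : ℝ))) := by gcongr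
    _ = _ := by ring

/-- On unit shells, polynomial growth is beaten by the Gaussian tail. Finiteness has to be known
beforehand: in `[0, ∞]` a quotient with infinite denominator is `0`, so `condNumber` would not
detect an infinite second moment. -/
theorem lintegral_enorm_sq_ne_top [IsProbabilityMeasure P] {X : Fin T → Ω₀ → Vec nx}
    (hX : ∀ t, Measurable (X t)) {σ r₁ r₂ K : ℝ} (hσ : 0 < σ) (hr₁ : 0 ≤ r₁) (hr₂ : 0 ≤ r₂)
    (htail : TrajectoryTail P X σ r₁ K) {G : Vec nx → Vec ny} {p : Polynomial ℝ}
    (hG : ∀ r : ℝ, r₂ ≤ r → ∀ z ∈ Metric.closedBall (0 : Vec nx) r, ‖G z‖ ≤ p.eval r)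
    (t : Fin T) : ∫⁻ ω, ‖G (X t ω)‖ₑ ^ 2 ∂P ≠ ⊤ := by
  obtain ⟨B, d, hB, hp⟩ := p.exists_abs_eval_le
  set R := r₁ + r₂ with hR
  have hR0 : 0 ≤ R := by positivity
  set a : ℕ → ℝ := fun k => (B * (1 + (R + k)) ^ d) ^ 2 with ha
  have hball : ∀ (k : ℕ) (z : Vec nx), ‖z‖ ≤ R + k → ‖G z‖ₑ ^ 2 ≤ ENNReal.ofReal (a k) := by
    intro k z hz
    have hk : (0 : ℝ) ≤ k := k.cast_nonneg
    have h1 := hG (R + k) (by linarith) z (by simpa using hz)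
    have h2 := (le_abs_self _).trans (hp (R + k) (by linarith))
    rw [← ofReal_norm, ← ENNReal.ofReal_pow (norm_nonneg _)]
    exact ENNReal.ofReal_le_ofReal (pow_le_pow_left₀ (norm_nonneg _) (h1.trans h2) 2)
  let S : ℕ → Set Ω₀ := fun k => {ω | X t ω ∉ Metric.closedBall (0 : Vec nx) (R + k)}
  have hS : ∀ k, MeasurableSet (S k) := fun k =>
    (hX t Metric.isClosed_closedBall.measurableSet).compl
  have hpt : ∀ ω, ‖G (X t ω)‖ₑ ^ 2 ≤ ENNReal.ofReal (a 0) +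
      ∑' k, (S k).indicator (fun _ => ENNReal.ofReal (a (k + 1))) ω := by
    intro ω
    classical
    have hex : ∃ k : ℕ, ‖X t ω‖ ≤ R + k := by
      obtain ⟨k, hk⟩ := exists_nat_ge ‖X t ω‖
      exact ⟨k, by linarith⟩
    -- With `j + 1` the least admissible index, the point lies in the ball of radius `R + j + 1` but
    -- outside that of radius `R + j`; hence the growth bound at `j + 1` is paired with the tail at
    -- `j`.
    rcases h : Nat.find hex with _ | j
    · have := Nat.find_spec hex
      rw [h] at this
      exact (hball 0 _ this).trans le_self_add
    · have h1 := Nat.find_spec hex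
      have h2 := Nat.find_min hex (m := j) (by omega)
      rw [h] at h1
      refine (hball (j + 1) _ h1).trans (le_trans ?_ le_add_self)
      refine le_trans (le_of_eq ?_) (ENNReal.le_tsum j)
      rw [Set.indicator_of_mem]
      simpa [S] using h2
  have hsum : Summable fun k : ℕ => a (k + 1) * (K * Real.exp (-(R + k) ^ 2 / σ ^ 2)) := by
    refine ((summable_pow_mul_exp_neg_sq hσ hR0 (2 * d)).mul_left (B ^ 2 * K)).congr fun k => ?_
    simp only [ha]
    push_cast
    ring
  refine ne_top_of_le_ne_top ?_ (lintegral_mono hpt)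
  rw [lintegral_add_left measurable_const, lintegral_const, measure_univ, mul_one,
    lintegral_tsum fun k => (measurable_const.indicator (hS k)).aemeasurable]
  refine ENNReal.add_ne_top.2 ⟨ENNReal.ofReal_ne_top, ?_⟩
  refine ne_top_of_le_ne_top (hsum.tsum_ofReal_ne_top) (ENNReal.tsum_le_tsum fun k => ?_)
  rw [lintegral_indicator_const (hS k), ENNReal.ofReal_mul (by positivity)]
  refine mul_le_mul_right ?_ _
  refine (measure_mono fun ω hω => ?_).trans (htail (R + k) ?_)
  · exact ⟨t, hω⟩
  · have : (0 : ℝ) ≤ k := k.cast_nonneg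
    linarith

/-- The square of `a` is integrable and its mean is at most `κ²` times the squared mean of `a`. -/
structure HypercontractiveWith (P : Measure Ω₀) (a : Ω₀ → ℝ) (κ : ℝ) : Prop where
  integrable : Integrable a P
  integrable_sq : Integrable (fun ω => a ω ^ 2) P
  integral_sq_le : ∫ ω, a ω ^ 2 ∂P ≤ κ ^ 2 * (∫ ω, a ω ∂P) ^ 2

theorem hypercontractiveWith_of_condNumber {Θ : Type*} {X : Fin T → Ω₀ → Vec nx}
    {f : Θ → Vec nx → Vec ny} {fstar : Vec nx → Vec ny} (θ : Θ) (t : Fin T)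
    (hX : Measurable (X t)) (hf : Measurable (f θ)) (hfs : Measurable fstar)
    (hfin : ∫⁻ ω, ‖f θ (X t ω) - fstar (X t ω)‖ₑ ^ 2 ∂P ≠ ⊤)
    (hc : condNumber P X f fstar ≠ ⊤) :
    HypercontractiveWith P (fun ω => ‖f θ (X t ω) - fstar (X t ω)‖ ^ 2)
      (condNumber P X f fstar).toReal := by
  have hm : Measurable fun ω => f θ (X t ω) - fstar (X t ω) :=
    (hf.comp hX).sub (hfs.comp hX)
  set g : Ω₀ → Vec ny := fun ω => f θ (X t ω) - fstar (X t ω) with hg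
  set E2 := ∫⁻ ω, ‖g ω‖ₑ ^ 2 ∂P with hE2
  set E4 := ∫⁻ ω, ‖g ω‖ₑ ^ 4 ∂P with hE4
  set κ := condNumber P X f fstar with hκ
  have hratio : E4 ^ (1 / 2 : ℝ) / E2 ≤ κ :=
    le_iSup₂ (f := fun (θ : Θ) (t : Fin T) =>
      (∫⁻ ω, ‖f θ (X t ω) - fstar (X t ω)‖ₑ ^ 4 ∂P) ^ (1 / 2 : ℝ) /
      ∫⁻ ω, ‖f θ (X t ω) - fstar (X t ω)‖ₑ ^ 2 ∂P) θ t
  have h42 : E4 ≤ (κ * E2) ^ 2 := by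
    by_cases h0 : E2 = 0
    · have hae : (fun ω => ‖g ω‖ₑ ^ 2) =ᵐ[P] 0 :=
        (lintegral_eq_zero_iff (by fun_prop)).1 h0
      have : E4 = 0 := by
        rw [hE4, lintegral_eq_zero_iff (by fun_prop)]
        filter_upwards [hae] with ω hω
        simpa using hω
      simp [this]
    · have h1 : E4 ^ (1 / 2 : ℝ) ≤ κ * E2 := by
        rwa [ENNReal.div_le_iff h0 hfin] at hratio
      calc E4 = (E4 ^ (1 / 2 : ℝ)) ^ 2 := by
            rw [← ENNReal.rpow_natCast, ← ENNReal.rpow_mul]; norm_num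
        _ ≤ _ := by gcongr
  have h4fin : E4 ≠ ⊤ := ne_top_of_le_ne_top
    (ENNReal.pow_ne_top (ENNReal.mul_ne_top hc hfin)) h42
  have e2 : ∀ ω, ENNReal.ofReal (‖g ω‖ ^ 2) = ‖g ω‖ₑ ^ 2 := fun ω => by
    rw [ENNReal.ofReal_pow (norm_nonneg _), ofReal_norm]
  have e4 : ∀ ω, ENNReal.ofReal ((‖g ω‖ ^ 2) ^ 2) = ‖g ω‖ₑ ^ 4 := fun ω => by
    rw [ENNReal.ofReal_pow (by positivity), e2, ← pow_mul]
  have i2 : ∫ ω, ‖g ω‖ ^ 2 ∂P = E2.toReal := by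
    rw [integral_eq_lintegral_of_nonneg_ae (Filter.Eventually.of_forall fun ω => by positivity)
      (Measurable.aestronglyMeasurable (by fun_prop))]
    simp_rw [e2]; rfl
  have i4 : ∫ ω, (‖g ω‖ ^ 2) ^ 2 ∂P = E4.toReal := by
    rw [integral_eq_lintegral_of_nonneg_ae (Filter.Eventually.of_forall fun ω => by positivity)
      (Measurable.aestronglyMeasurable (by fun_prop))]
    simp_rw [e4]; rfl
  refine ⟨⟨Measurable.aestronglyMeasurable (by fun_prop), ?_⟩,
    ⟨Measurable.aestronglyMeasurable (by fun_prop), ?_⟩, ?_⟩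
  · rw [hasFiniteIntegral_iff_ofReal (Filter.Eventually.of_forall fun ω => by positivity)]
    exact (lintegral_congr e2).trans_lt hfin.lt_top
  · rw [hasFiniteIntegral_iff_ofReal (Filter.Eventually.of_forall fun ω => by positivity)]
    exact (lintegral_congr e4).trans_lt h4fin.lt_top
  · rw [i2, i4, ← mul_pow, ← ENNReal.toReal_mul, ← ENNReal.toReal_pow]
    exact ENNReal.toReal_mono (ENNReal.pow_ne_top (ENNReal.mul_ne_top hc hfin)) h42

/-- The variance is nonnegative, so the second moment is at least the squared mean. -/
theorem HypercontractiveWith.one_le [IsProbabilityMeasure P] {a : Ω₀ → ℝ} {κ : ℝ}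
    (h : HypercontractiveWith P a κ) (hκ : 0 ≤ κ) (hm : ∫ ω, a ω ∂P ≠ 0) : 1 ≤ κ := by
  set M := ∫ ω, a ω ∂P with hM
  have h1 : 0 ≤ ∫ ω, (a ω ^ 2 - 2 * M * a ω + M ^ 2) ∂P :=
    integral_nonneg fun ω => by
      simp only [Pi.zero_apply]; nlinarith [sq_nonneg (a ω - M)]
  rw [integral_add (f := fun ω => a ω ^ 2 - 2 * M * a ω)
    (h.integrable_sq.sub (h.integrable.const_mul _)) (integrable_const _),
    integral_sub h.integrable_sq (h.integrable.const_mul _), integral_const_mul, ← hM] at h1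
  simp only [integral_const, probReal_univ, smul_eq_mul, one_mul] at h1
  have h2 := h.integral_sq_le
  have h3 : 0 < M ^ 2 := by positivity
  have h4 : 1 ≤ κ ^ 2 := by nlinarith
  nlinarith

/-- The part of the mean carried by an unlikely event is negligible. -/
theorem HypercontractiveWith.setIntegral_le [IsProbabilityMeasure P] {a : Ω₀ → ℝ} {κ : ℝ}
    (h : HypercontractiveWith P a κ) (ha : ∀ ω, 0 ≤ a ω) (hκ : 0 < κ) {S : Set Ω₀}
    (hPS : κ ^ 2 * P.real S ≤ 1 / 64) :
    ∫ ω in S, a ω ∂P ≤ (∫ ω, a ω ∂P) / 8 := by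
  set M := ∫ ω, a ω ∂P with hM
  have hM0 : 0 ≤ M := integral_nonneg ha
  rcases hM0.eq_or_lt with h0 | h0
  · have := setIntegral_le_integral (s := S) h.integrable (Filter.Eventually.of_forall ha)
    linarith
  -- With `a ≤ a² / (2τ) + τ / 2`, this choice makes each of the two terms contribute at most `M /
  -- 16`.
  set τ := 8 * κ ^ 2 * M with hτ
  have hτ0 : 0 < τ := by positivity
  calc ∫ ω in S, a ω ∂P ≤ ∫ ω in S, (a ω ^ 2 / (2 * τ) + τ / 2) ∂P := by
        refine setIntegral_mono h.integrable.integrableOn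
          ((h.integrable_sq.div_const _).add (integrable_const _)).integrableOn fun ω => ?_
        rw [← sub_nonneg]
        have : a ω ^ 2 / (2 * τ) + τ / 2 - a ω = (a ω - τ) ^ 2 / (2 * τ) := by
          field_simp; ring
        rw [this]; positivity
    _ = (∫ ω in S, a ω ^ 2 ∂P) / (2 * τ) + τ / 2 * P.real S := by
        rw [integral_add (h.integrable_sq.div_const _).integrableOn
          (integrable_const _), integral_div, setIntegral_const, smul_eq_mul,
          mul_comm (P.real S)]
    _ ≤ κ ^ 2 * M ^ 2 / (2 * τ) + τ / 2 * P.real S := by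
        gcongr
        exact (setIntegral_le_integral h.integrable_sq
          (Filter.Eventually.of_forall fun ω => sq_nonneg _)).trans h.integral_sq_le
    _ ≤ M / 8 := by
        have h1 : κ ^ 2 * M ^ 2 / (2 * τ) = M / 16 := by
          rw [hτ]; field_simp; ring
        rw [h1, hτ]
        nlinarith

/-- Cauchy–Schwarz with weights `M t = E a_t` gives `(∑ a_t)² ≤ (∑ M t) ∑ a_t² / M t`, and `E a_t² /
M t ≤ κ² M t`. No relation between different times is needed; where `M t = 0`, `a_t` vanishes almost
surely, in agreement with `x / 0 = 0`. -/
theorem HypercontractiveWith.sum {κ : ℝ} {a : Fin T → Ω₀ → ℝ}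
    (ha : ∀ t ω, 0 ≤ a t ω) (h : ∀ t, HypercontractiveWith P (a t) κ) :
    HypercontractiveWith P (fun ω => ∑ t, a t ω) κ := by
  have hint : Integrable (fun ω => ∑ t, a t ω) P :=
    integrable_finsetSum _ fun t _ => (h t).integrable
  set M : Fin T → ℝ := fun t => ∫ ω, a t ω ∂P with hM
  have hM0 : ∀ t, 0 ≤ M t := fun t => integral_nonneg (ha t)
  have hint2 : Integrable (fun ω => (∑ t, M t) * ∑ t, a t ω ^ 2 / M t) P :=
    (integrable_finsetSum _ fun t _ => (h t).integrable_sq.div_const _).const_mul _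
  have hae : ∀ᵐ ω ∂P, (∑ t, a t ω) ^ 2 ≤ (∑ t, M t) * ∑ t, a t ω ^ 2 / M t := by
    have hz : ∀ᵐ ω ∂P, ∀ t, M t = 0 → a t ω = 0 := by
      refine ae_all_iff.2 fun t => ?_
      by_cases h0 : M t = 0
      · filter_upwards [(integral_eq_zero_iff_of_nonneg (ha t) (h t).integrable).1 h0] with ω hω _
        exact hω
      · exact Filter.Eventually.of_forall fun ω h1 => absurd h1 h0
    filter_upwards [hz] with ω hω
    refine Finset.sum_sq_le_sum_mul_sum_of_sq_le_mul _ (fun t _ => hM0 t)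
      (fun t _ => div_nonneg (sq_nonneg _) (hM0 t)) fun t _ => ?_
    by_cases h0 : M t = 0
    · simp [hω t h0]
    · exact le_of_eq (by field_simp)
  refine ⟨hint, hint2.mono' (hint.aestronglyMeasurable.pow 2) ?_, ?_⟩
  · filter_upwards [hae] with ω hω
    rwa [Real.norm_of_nonneg (sq_nonneg _)]
  · calc ∫ ω, (∑ t, a t ω) ^ 2 ∂P ≤ ∫ ω, (∑ t, M t) * ∑ t, a t ω ^ 2 / M t ∂P :=
          integral_mono_of_nonneg (Filter.Eventually.of_forall fun ω => sq_nonneg _) hint2 hae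
      _ = (∑ t, M t) * ∑ t, (∫ ω, a t ω ^ 2 ∂P) / M t := by
          rw [integral_const_mul, integral_finsetSum _ fun t _ => (h t).integrable_sq.div_const _]
          simp_rw [integral_div]
      _ ≤ (∑ t, M t) * ∑ t, κ ^ 2 * M t := by
          have : 0 ≤ ∑ t, M t := Finset.sum_nonneg fun t _ => hM0 t
          gcongr with t _
          rcases (hM0 t).eq_or_lt with h0 | h0
          · simp [← h0]
          · rw [div_le_iff₀ h0]
            exact (h t).integral_sq_le.trans_eq (by simp only [hM]; ring)
      _ = κ ^ 2 * (∫ ω, ∑ t, a t ω ∂P) ^ 2 := by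
          rw [integral_finsetSum _ fun t _ => (h t).integrable, ← Finset.mul_sum]
          ring

/-- Comparison of means of two functions that are close off an unlikely event. -/
theorem HypercontractiveWith.integral_le_of_close [IsProbabilityMeasure P] {a b : Ω₀ → ℝ} {κ : ℝ}
    (h : HypercontractiveWith P a κ) (ha : ∀ ω, 0 ≤ a ω) (hκ : 0 < κ) (hb : ∀ ω, 0 ≤ b ω)
    (hbi : Integrable b P) {S : Set Ω₀} (hS : MeasurableSet S) (hPS : κ ^ 2 * P.real S ≤ 1 / 64)
    {e : ℝ} (he : 0 ≤ e) (hclose : ∀ ω, ω ∉ S → a ω ≤ 9 / 8 * b ω + e) :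
    7 / 8 * ∫ ω, a ω ∂P ≤ 9 / 8 * ∫ ω, b ω ∂P + e := by
  have h1 := integral_add_compl hS h.integrable
  have h2 := h.setIntegral_le ha hκ hPS
  have hi : Integrable (fun ω => 9 / 8 * b ω + e) P := (hbi.const_mul _).add (integrable_const _)
  have h3 : ∫ ω in Sᶜ, a ω ∂P ≤ ∫ ω, (9 / 8 * b ω + e) ∂P :=
    (setIntegral_mono_on h.integrable.integrableOn hi.integrableOn hS.compl
      fun ω hω => hclose ω hω).trans (setIntegral_le_integral hi
        (Filter.Eventually.of_forall fun ω => by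
          have := hb ω
          simp only [Pi.zero_apply]; positivity))
  rw [integral_add (hbi.const_mul _) (integrable_const _), integral_const_mul, integral_const,
    probReal_univ, one_smul] at h3
  linarith

end Moments

/-! ### Choice of radius, noise level, resolution and deviation level -/

section Scales

set_option maxHeartbeats 1000000 in
/-- Radius `r` of the data, level `a` of the noise, resolution `ε` of the net and deviation level
`u` for which all error terms are negligible, with `u` logarithmic in all the parameters. -/
theorem exists_scales (ny : ℕ) (r₁ r₂ K A : ℝ) (hr₁ : 0 ≤ r₁) (hr₂ : 0 ≤ r₂) (hK : 0 < K)
    (hA : 0 < A) (p : Polynomial ℝ) :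
    ∃ C c : ℝ, 0 < C ∧ 0 < c ∧ ∀ (N n : ℕ) (σ dim δ κ : ℝ), 2 ≤ n → N ≤ n → 0 < N → 0 < σ →
      1 ≤ dim → 0 < δ → δ ≤ 1 → 1 ≤ κ →
      c * (1 + |Real.log σ|) * κ ^ 2 * (dim + Real.log (1 / δ)) ≤ N / Real.log n →
      ∃ r a ε u : ℝ, r₁ ≤ r ∧ r₂ ≤ r ∧ 0 < ε ∧ ε ≤ 1 ∧ 0 ≤ a ∧
        σ * ny * a * (|p.eval r| * ε) ≤ σ ^ 2 / n ∧ (|p.eval r| * ε) ^ 2 ≤ σ ^ 2 / n ∧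
        N * (K * Real.exp (-r ^ 2 / σ ^ 2)) ≤ δ / 4 ∧
        κ ^ 2 * (K * Real.exp (-r ^ 2 / σ ^ 2)) ≤ 1 / 64 ∧
        n * (2 * ny * Real.exp (1 / 2 - a)) ≤ δ / 4 ∧
        (A / ε) ^ dim * Real.exp (-(N / (8 * κ ^ 2))) ≤ δ / 4 ∧
        (A / ε) ^ dim * Real.exp (-u) ≤ δ / 4 ∧
        54 * (u + 1) ≤ C * ((1 + |Real.log σ|) * Real.log n) * (dim + Real.log (1 / δ)) := by
  obtain ⟨B, d, hB, hp⟩ := p.exists_abs_eval_le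
  set R : ℝ := 64 * K + 3 with hR
  set a₀ : ℝ := 8 * ny + 3 with ha₀
  set ks : ℝ := 3 + 2 * ny + 2 * a₀ with hks
  set kr : ℝ := 2 * (1 + r₁ + r₂ + R) + 3 with hkr
  set kp : ℝ := 2 * B + d * kr with hkp
  set kε : ℝ := kp + ks + 6 with hkε
  set q : ℝ := 2 * A + kε with hq
  have hny : (0 : ℝ) ≤ ny := ny.cast_nonneg
  have hd : (0 : ℝ) ≤ d := d.cast_nonneg
  have hR3 : 3 ≤ R := by linarith
  have ha₀3 : 3 ≤ a₀ := by linarith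
  have hks0 : 0 ≤ ks := by linarith
  have hkr0 : 0 ≤ kr := by linarith
  have hkp0 : 0 ≤ kp := by positivity
  have hkε0 : 0 ≤ kε := by linarith
  have hq0 : 0 ≤ q := by linarith
  clear_value R a₀ ks kr kp kε q
  refine ⟨54 * (q + 8), 8 * (q + 6) + 2, by positivity, by positivity, ?_⟩
  intro N n σ dim δ κ hn hNn hN0 hσ hdim hδ hδ1 hκ hcond
  have hnR : (2 : ℝ) ≤ n := by exact_mod_cast hn
  have hNnR : (N : ℝ) ≤ n := by exact_mod_cast hNn
  have hNR : (1 : ℝ) ≤ N := by exact_mod_cast hN0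
  have hlog2 : 1 / 2 ≤ Real.log n := by
    have := Real.log_two_gt_d9
    have := Real.log_le_log (by norm_num) hnR
    linarith
  have hlogn0 : 0 < Real.log n := by linarith
  have hlσ : 0 ≤ |Real.log σ| := abs_nonneg _
  -- All quantities are compared with powers of `e^L`: `n ≤ e^L`, `σ` and `1/σ` are at most
  -- `e^{2L}`, and a constant `x ≥ 0` is at most `e^{2xL}` because `L ≥ 1/2`.
  set L : ℝ := (1 + |Real.log σ|) * Real.log n with hL
  set lδ : ℝ := Real.log (1 / δ) with hlδ
  have hlδ0 : 0 ≤ lδ := Real.log_nonneg (by rw [le_div_iff₀ hδ]; linarith)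
  set D : ℝ := dim + lδ with hD
  have hD1 : 1 ≤ D := by linarith
  have hLn : Real.log n ≤ L := le_mul_of_one_le_left hlogn0.le (by linarith)
  have hL2 : 1 / 2 ≤ L := hlog2.trans hLn
  have hLσ : |Real.log σ| ≤ 2 * L := by
    have := mul_le_mul_of_nonneg_left hlog2 hlσ
    rw [hL, add_mul, one_mul]
    linarith
  have hκ2 : 1 ≤ κ ^ 2 := one_le_pow₀ hκ
  have hNbig : (8 * (q + 6) + 2) * (L * κ ^ 2 * D) ≤ N := by
    rw [le_div_iff₀ hlogn0] at hcond
    calc _ = (8 * (q + 6) + 2) * (1 + |Real.log σ|) * κ ^ 2 * D * Real.log n := by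
          rw [hL]; ring
      _ ≤ N := hcond
  clear_value L lδ D
  have hLκD : 0 ≤ L * κ ^ 2 * D :=
    mul_nonneg (mul_nonneg (by linarith) (by positivity)) (by linarith)
  have h2N : 2 * (L * κ ^ 2 * D) ≤ N := by
    have := mul_nonneg hq0 hLκD
    linarith
  have hκD : κ ^ 2 * D ≤ N := by
    have h0 : 0 ≤ κ ^ 2 * D := mul_nonneg (by positivity) (by linarith)
    have h1 := mul_le_mul_of_nonneg_right hL2 h0
    rw [← mul_assoc] at h1
    linarith
  have hDN : D ≤ N := (le_mul_of_one_le_left (by linarith) hκ2).trans hκD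
  have hκN : κ ^ 2 ≤ N := (le_mul_of_one_le_right (by linarith) hD1).trans hκD
  have hδn : 1 / δ ≤ Real.exp n := by
    rw [← Real.exp_log (by positivity : 0 < 1 / δ), ← hlδ]
    exact Real.exp_le_exp.2 (by linarith)
  have hδexp : 1 / δ = Real.exp lδ := by rw [hlδ, Real.exp_log (by positivity)]
  have hself : ∀ x : ℝ, x ≤ Real.exp x := fun x => by linarith [Real.add_one_le_exp x]
  have hnL : (n : ℝ) ≤ Real.exp L := by
    rw [← Real.exp_log (by linarith : (0 : ℝ) < n)]
    exact Real.exp_le_exp.2 hLn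
  have hσL : σ ≤ Real.exp (2 * L) := by
    rw [← Real.exp_log hσ]
    exact Real.exp_le_exp.2 ((le_abs_self _).trans hLσ)
  have hσL' : Real.exp (-(2 * L)) ≤ σ := by
    conv_rhs => rw [← Real.exp_log hσ]
    exact Real.exp_le_exp.2 (by linarith [neg_abs_le (Real.log σ)])
  have hconst : ∀ x : ℝ, 0 ≤ x → x ≤ Real.exp (2 * x * L) := fun x hx =>
    (hself x).trans (Real.exp_le_exp.2 (by
      have := mul_le_mul_of_nonneg_left hL2 hx
      linarith))
  have hσn : Real.exp (-(5 * L)) ≤ σ ^ 2 / n := by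
    rw [le_div_iff₀ (by linarith)]
    calc Real.exp (-(5 * L)) * n ≤ Real.exp (-(5 * L)) * Real.exp L := by gcongr
      _ = Real.exp (-(2 * L)) ^ 2 := by rw [← Real.exp_add, ← Real.exp_nat_mul]; ring_nf
      _ ≤ σ ^ 2 := by gcongr
  -- Neither `r` nor `a` involves `δ` or `κ`: the sample-size condition forces `log (1/δ) ≤ n` and
  -- `κ² ≤ n`, so taking both linear in `n` is enough.
  obtain ⟨r, hr⟩ : ∃ r : ℝ, r = R * σ * n + r₁ + r₂ := ⟨_, rfl⟩
  obtain ⟨a, ha⟩ : ∃ a : ℝ, a = a₀ * n := ⟨_, rfl⟩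
  have hRσn : 0 ≤ R * σ * n := by positivity
  have hr0 : 0 ≤ r := by rw [hr]; positivity
  have hr1 : 1 + r ≤ Real.exp (kr * L) := by
    have e1 : σ * n ≤ Real.exp (3 * L) := by
      calc σ * n ≤ Real.exp (2 * L) * Real.exp L := by gcongr
        _ = Real.exp (3 * L) := by rw [← Real.exp_add]; ring_nf
    have e2 : 1 ≤ Real.exp (3 * L) := Real.one_le_exp (by linarith)
    calc 1 + r = (1 + r₁ + r₂) * 1 + R * (σ * n) := by rw [hr]; ring
      _ ≤ (1 + r₁ + r₂) * Real.exp (3 * L) + R * Real.exp (3 * L) := by gcongr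
      _ = (1 + r₁ + r₂ + R) * Real.exp (3 * L) := by ring
      _ ≤ Real.exp (2 * (1 + r₁ + r₂ + R) * L) * Real.exp (3 * L) := by
          gcongr
          exact hconst _ (by positivity)
      _ = Real.exp (kr * L) := by rw [← Real.exp_add, hkr]; ring_nf
  have hpr : |p.eval r| ≤ Real.exp (kp * L) := by
    calc |p.eval r| ≤ B * (1 + r) ^ d := hp r hr0
      _ ≤ Real.exp (2 * B * L) * Real.exp (kr * L) ^ d := by
          gcongr
          exact hconst _ (by positivity)
      _ = Real.exp (kp * L) := by
          rw [← Real.exp_nat_mul, ← Real.exp_add, hkp]; ring_nf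
  have hs : σ * ny * a ≤ Real.exp (ks * L) := by
    calc σ * ny * a = σ * ny * (a₀ * n) := by rw [ha]
      _ ≤ Real.exp (2 * L) * Real.exp (2 * ny * L) * (Real.exp (2 * a₀ * L) * Real.exp L) := by
          gcongr
          · exact hconst _ hny
          · exact hconst _ (by positivity)
      _ = Real.exp (ks * L) := by
          rw [← Real.exp_add, ← Real.exp_add, ← Real.exp_add, hks]; ring_nf
  have hη : |p.eval r| * Real.exp (-(kε * L)) ≤ Real.exp (-((ks + 6) * L)) := by
    calc _ ≤ Real.exp (kp * L) * Real.exp (-(kε * L)) := by gcongr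
      _ = _ := by rw [← Real.exp_add, hkε]; ring_nf
  have hη0 : 0 ≤ |p.eval r| * Real.exp (-(kε * L)) := by positivity
  have hrσ : 64 * K + 2 * n ≤ r ^ 2 / σ ^ 2 := by
    rw [le_div_iff₀ (by positivity)]
    have h1 : 64 * K + 2 * n ≤ R * n := by
      have := mul_le_mul_of_nonneg_left hnR hK.le
      rw [hR]
      linarith
    have h2 : R * n ≤ (R * n) ^ 2 := by
      have : 1 ≤ R * n := by linarith
      exact le_self_pow₀ this two_ne_zero
    calc (64 * K + 2 * n) * σ ^ 2 ≤ (R * n) ^ 2 * σ ^ 2 := by gcongr; linarith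
      _ = (R * σ * n) ^ 2 := by ring
      _ ≤ r ^ 2 := by gcongr; linarith
  -- The first factor absorbs `K` and produces `1/64`, the second absorbs `N` or `κ²`, and the third
  -- is at most `δ`.
  have htail : Real.exp (-r ^ 2 / σ ^ 2)
      ≤ Real.exp (-(64 * K)) * Real.exp (-(n : ℝ)) * Real.exp (-(n : ℝ)) := by
    rw [← Real.exp_add, ← Real.exp_add, neg_div]
    exact Real.exp_le_exp.2 (by linarith)
  have hx1 : ∀ x : ℝ, x * Real.exp (-x) ≤ 1 := fun x => by
    rw [Real.exp_neg, ← div_eq_mul_inv, div_le_one (Real.exp_pos x)]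
    exact hself x
  have hK64 : K * Real.exp (-(64 * K)) ≤ 1 / 64 := by linarith [hx1 (64 * K)]
  have hexpδ : Real.exp (-(n : ℝ)) ≤ δ := by
    rw [Real.exp_neg]
    rw [one_div] at hδn
    exact inv_le_of_inv_le₀ hδ hδn
  have hNexp : (N : ℝ) * Real.exp (-(n : ℝ)) ≤ 1 :=
    (mul_le_mul_of_nonneg_right hNnR (Real.exp_pos _).le).trans (hx1 n)
  have hexp1 : Real.exp (-(n : ℝ)) ≤ 1 := Real.exp_le_one_iff.2 (by linarith)
  have hAε : (A / Real.exp (-(kε * L))) ^ dim ≤ Real.exp (dim * (q * L)) := by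
    have h1 : A / Real.exp (-(kε * L)) ≤ Real.exp (q * L) := by
      rw [Real.exp_neg, div_inv_eq_mul]
      calc A * Real.exp (kε * L) ≤ Real.exp (2 * A * L) * Real.exp (kε * L) := by
            gcongr
            exact hconst _ hA.le
        _ = Real.exp (q * L) := by rw [← Real.exp_add, hq]; ring_nf
    calc _ ≤ (Real.exp (q * L)) ^ dim :=
          Real.rpow_le_rpow (by positivity) h1 (by linarith)
      _ = _ := by rw [← Real.exp_mul]; ring_nf
  -- Here `dim * (q * L)` bounds the log-cardinality of the net, and the rest makes the union bound
  -- equal to `δ / 4`.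
  obtain ⟨u, hu⟩ : ∃ u : ℝ, u = dim * (q * L) + Real.log 4 + lδ := ⟨_, rfl⟩
  have hlog4 : Real.log 4 ≤ 2 := by
    have : (4 : ℝ) = 2 ^ 2 := by norm_num
    rw [this, Real.log_pow]
    have := Real.log_two_lt_d9
    push_cast
    linarith
  have hLD : 1 / 2 ≤ L * D := hL2.trans (le_mul_of_one_le_right (by linarith) hD1)
  have hu6 : u ≤ (q + 6) * (L * D) := by
    have h1 : lδ ≤ 2 * L * lδ := le_mul_of_one_le_left hlδ0 (by linarith)
    have h2 : dim * (q * L) + q * L * lδ = q * (L * D) := by rw [hD]; ring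
    have h3 : 0 ≤ q * L * lδ := by positivity
    have h4 : 2 * L * lδ ≤ 2 * (L * D) := by
      have := mul_le_mul_of_nonneg_left (by linarith : lδ ≤ D) (by linarith : 0 ≤ L)
      linarith
    linarith
  have hQu : (A / Real.exp (-(kε * L))) ^ dim * Real.exp (-u) ≤ δ / 4 := by
    calc _ ≤ Real.exp (dim * (q * L)) * Real.exp (-u) := by gcongr
      _ = (Real.exp lδ)⁻¹ * (Real.exp (Real.log 4))⁻¹ := by
          rw [← Real.exp_neg, ← Real.exp_neg, ← Real.exp_add, ← Real.exp_add, hu]; ring_nf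
      _ = δ / 4 := by
          rw [← hδexp, Real.exp_log (by norm_num)]; field_simp
  refine ⟨r, a, Real.exp (-(kε * L)), u, by linarith, by linarith, Real.exp_pos _,
    Real.exp_le_one_iff.2 (by have := mul_nonneg hkε0 (by linarith : 0 ≤ L); linarith),
    by rw [ha]; positivity, ?_, ?_, ?_, ?_, ?_, ?_, hQu, ?_⟩
  · calc _ ≤ Real.exp (ks * L) * Real.exp (-((ks + 6) * L)) := by gcongr
      _ = Real.exp (-(6 * L)) := by rw [← Real.exp_add]; ring_nf
      _ ≤ Real.exp (-(5 * L)) := Real.exp_le_exp.2 (by linarith)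
      _ ≤ _ := hσn
  · calc _ ≤ Real.exp (-((ks + 6) * L)) ^ 2 := by gcongr
      _ = Real.exp (-(2 * (ks + 6) * L)) := by rw [← Real.exp_nat_mul]; ring_nf
      _ ≤ Real.exp (-(5 * L)) := Real.exp_le_exp.2 (by
          have := mul_nonneg hks0 (by linarith : 0 ≤ L)
          linarith)
      _ ≤ _ := hσn
  · calc _ ≤ N * (K * (Real.exp (-(64 * K)) * Real.exp (-(n : ℝ)) * Real.exp (-(n : ℝ)))) := by
          gcongr
      _ = (K * Real.exp (-(64 * K))) * (N * Real.exp (-(n : ℝ))) * Real.exp (-(n : ℝ)) := by ring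
      _ ≤ 1 / 64 * 1 * δ := by gcongr
      _ ≤ δ / 4 := by linarith
  · calc _ ≤ N * (K * (Real.exp (-(64 * K)) * Real.exp (-(n : ℝ)) * Real.exp (-(n : ℝ)))) := by
          gcongr
      _ = (K * Real.exp (-(64 * K))) * (N * Real.exp (-(n : ℝ))) * Real.exp (-(n : ℝ)) := by ring
      _ ≤ 1 / 64 * 1 * 1 := by gcongr
      _ = 1 / 64 := by norm_num
  · have h1 : Real.exp (1 / 2 - a)
        ≤ Real.exp (-(8 * (ny : ℝ))) * Real.exp (-(n : ℝ)) * Real.exp (-(n : ℝ)) := by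
      rw [← Real.exp_add, ← Real.exp_add]
      refine Real.exp_le_exp.2 ?_
      have := mul_le_mul_of_nonneg_left hnR hny
      rw [ha, ha₀]
      linarith
    have h2 : 2 * ny * Real.exp (-(8 * (ny : ℝ))) ≤ 1 / 4 := by linarith [hx1 (8 * ny)]
    calc _ ≤ n * (2 * ny *
          (Real.exp (-(8 * (ny : ℝ))) * Real.exp (-(n : ℝ)) * Real.exp (-(n : ℝ)))) := by gcongr
      _ = (2 * ny * Real.exp (-(8 * (ny : ℝ)))) * (n * Real.exp (-(n : ℝ)))
          * Real.exp (-(n : ℝ)) := by ring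
      _ ≤ 1 / 4 * 1 * δ := by
          gcongr
          exact hx1 n
      _ = δ / 4 := by ring
  · refine le_trans ?_ hQu
    gcongr
    rw [le_div_iff₀ (by positivity)]
    calc u * (8 * κ ^ 2) ≤ (q + 6) * (L * D) * (8 * κ ^ 2) := by gcongr
      _ = 8 * (q + 6) * (L * κ ^ 2 * D) := by ring
      _ ≤ N := by linarith
  · have : 54 * (q + 8) * L * D = 54 * ((q + 6) * (L * D) + 2 * (L * D)) := by ring
    rw [this]
    linarith

end Scales

/-! ### The basic inequality on a fixed sample -/

section Deterministic

/-- Basic inequality of penalized least squares, transferred to a nearby function of a net. -/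
theorem sum_norm_sq_le_of_basic {ι : Type*} [Fintype ι] {ny : ℕ} {v g g' : ι → Vec ny}
    {n s η σ u b R : ℝ} (hn : n = Fintype.card ι) (hn0 : 0 < n) (hR : 0 ≤ R)
    (hbasic : 1 / n * ∑ p, ‖v p - g p‖ ^ 2 + R ≤ 1 / n * ∑ p, ‖v p‖ ^ 2 + b)
    (hv : ∀ p, ‖v p‖ ≤ s) (hη : ∀ p, ‖g p - g' p‖ ≤ η)
    (hsη : s * η ≤ σ ^ 2 / n) (hη2 : η ^ 2 ≤ σ ^ 2 / n)
    (hdev : ∑ p, inner ℝ (v p) (g' p) ≤ 1 / 16 * ∑ p, ‖g' p‖ ^ 2 + 8 * σ ^ 2 * u) :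
    ∑ p, ‖g' p‖ ^ 2 ≤ 72 / 55 * (16 * σ ^ 2 * u + 25 / 8 * σ ^ 2 + n * b) + 9 * σ ^ 2 := by
  have h1 : ∑ p, ‖v p - g p‖ ^ 2
      = ∑ p, ‖v p‖ ^ 2 - 2 * ∑ p, inner ℝ (v p) (g p) + ∑ p, ‖g p‖ ^ 2 := by
    rw [Finset.mul_sum, ← Finset.sum_sub_distrib, ← Finset.sum_add_distrib]
    exact Finset.sum_congr rfl fun p _ => norm_sub_sq_real _ _
  have h2 : ∑ p, ‖g p‖ ^ 2 ≤ 2 * ∑ p, inner ℝ (v p) (g p) + n * b := by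
    rw [h1] at hbasic
    have h3 := mul_le_mul_of_nonneg_left hbasic hn0.le
    have e1 : n * (1 / n * (∑ p, ‖v p‖ ^ 2 - 2 * ∑ p, inner ℝ (v p) (g p) + ∑ p, ‖g p‖ ^ 2) + R)
        = (∑ p, ‖v p‖ ^ 2 - 2 * ∑ p, inner ℝ (v p) (g p) + ∑ p, ‖g p‖ ^ 2) + n * R := by
      field_simp
    have e2 : n * (1 / n * ∑ p, ‖v p‖ ^ 2 + b) = ∑ p, ‖v p‖ ^ 2 + n * b := by field_simp
    rw [e1, e2] at h3
    have := mul_nonneg hn0.le hR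
    linarith
  have hsum : ∀ c : ℝ, ∑ _p : ι, c = n * c := fun c => by
    rw [Finset.sum_const, Finset.card_univ, nsmul_eq_mul, hn]
  have h3 : ∑ p, inner ℝ (v p) (g p) ≤ ∑ p, inner ℝ (v p) (g' p) + σ ^ 2 := by
    calc ∑ p, inner ℝ (v p) (g p) ≤ ∑ p, (inner ℝ (v p) (g' p) + σ ^ 2 / n) := by
          refine Finset.sum_le_sum fun p _ => ?_
          have e : inner ℝ (v p) (g p) = inner ℝ (v p) (g' p) + inner ℝ (v p) (g p - g' p) := by
            rw [inner_sub_right]; ring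
          have := (real_inner_le_norm (v p) (g p - g' p)).trans
            (mul_le_mul (hv p) (hη p) (norm_nonneg _) ((norm_nonneg _).trans (hv p)))
          linarith
      _ = _ := by rw [Finset.sum_add_distrib, hsum]; field_simp
  have h4 : ∑ p, ‖g' p‖ ^ 2 ≤ 9 / 8 * ∑ p, ‖g p‖ ^ 2 + 9 * σ ^ 2 := by
    calc ∑ p, ‖g' p‖ ^ 2 ≤ ∑ p, (9 / 8 * ‖g p‖ ^ 2 + 9 * (σ ^ 2 / n)) := by
          refine Finset.sum_le_sum fun p _ => ?_
          have e1 : ‖g' p‖ ≤ ‖g p‖ + η := by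
            have := norm_sub_norm_le (g' p) (g p)
            rw [norm_sub_rev] at this
            linarith [hη p]
          have e2 := pow_le_pow_left₀ (norm_nonneg _) e1 2
          nlinarith [sq_nonneg (‖g p‖ - 8 * η)]
      _ = _ := by
          rw [Finset.sum_add_distrib, hsum, ← Finset.mul_sum]; field_simp
  -- With `S' = ∑ ‖g'‖²`, the estimates chain to `S' ≤ 9/8 (S'/8 + 16σ²u + 2σ² + nb) + 9σ²`.
  -- Absorbing `9/64 S'` leaves the factor `55/64`, whence `72/55` and `25/8 = 2 + 9/8`.
  linarith

end Deterministic

/-! ### The net and the probabilities of the exceptional events -/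

section Events

variable {Ω₀ Ω Θ : Type*} [MeasurableSpace Ω₀] [MeasurableSpace Ω] {P : Measure Ω₀}
  {μ : Measure Ω} {nx ny T N : ℕ} {X : Fin T → Ω₀ → Vec nx} {V Y : Fin T → Ω₀ → Vec ny}
  {x : Fin N → Fin T → Ω → Vec nx} {y : Fin N → Fin T → Ω → Vec ny}

theorem RegularClass.exists_finset_net [PseudoMetricSpace Θ] {f : Θ → Vec nx → Vec ny}
    {fstar : Vec nx → Vec ny} {r₂ A dim : ℝ} {p₁ p₂ : Polynomial ℝ}
    (h : RegularClass f fstar r₂ A dim p₁ p₂) (hA : 0 < A) {ε : ℝ} (hε : 0 < ε) (hε1 : ε ≤ 1) :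
    ∃ C : Finset Θ, (C.card : ℝ) ≤ (A / ε) ^ dim ∧ ∀ θ, ∃ θ' ∈ C, dist θ θ' ≤ ε := by
  lift ε to ℝ≥0 using hε.le
  have hcov := h.covering ε (by exact_mod_cast hε) (by exact_mod_cast hε1)
  have hne : Metric.coveringNumber ε (Set.univ : Set Θ) ≠ ⊤ := by
    intro htop
    rw [htop] at hcov
    simp at hcov
  obtain ⟨C, -, hfin, hC, hcard⟩ := Metric.exists_set_encard_eq_coveringNumber hne
  refine ⟨hfin.toFinset, ?_, fun θ => ?_⟩
  · rw [← hcard, hfin.encard_eq_coe_toFinset_card] at hcov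
    have h0 : 0 ≤ (A / (ε : ℝ)) ^ dim := by positivity
    rw [← ENNReal.ofReal_le_ofReal_iff h0, ENNReal.ofReal_natCast]
    simpa using hcov
  · obtain ⟨θ', hθ', hd⟩ := hC (Set.mem_univ θ)
    refine ⟨θ', by simpa using hθ', ?_⟩
    have hd' : edist θ θ' ≤ ε := hd
    rw [edist_dist, ENNReal.ofReal_le_iff_le_toReal ENNReal.coe_ne_top] at hd'
    simpa using hd'

theorem measure_exists_rollout_mem_le {E : Type*} [MeasurableSpace E] {Z : Fin N → Ω → E}
    {Z₀ : Ω₀ → E} (hid : ∀ i, IdentDistrib (Z i) Z₀ μ P) {S : Set E} (hS : MeasurableSet S)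
    {b : ℝ} (hb : P {ω | Z₀ ω ∈ S} ≤ ENNReal.ofReal b) :
    μ {ω | ∃ i, Z i ω ∈ S} ≤ ENNReal.ofReal (N * b) := by
  have hU : {ω | ∃ i, Z i ω ∈ S} = ⋃ i, {ω | Z i ω ∈ S} := by ext; simp
  rw [hU]
  refine (measure_iUnion_le _).trans ?_
  rw [tsum_fintype]
  calc ∑ i, μ {ω | Z i ω ∈ S} ≤ ∑ _i : Fin N, ENNReal.ofReal b :=
        Finset.sum_le_sum fun i _ => ((hid i).measure_mem_eq hS).trans_le hb
    _ = ENNReal.ofReal (N * b) := by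
        rw [Finset.sum_const, Finset.card_univ, Fintype.card_fin, nsmul_eq_mul,
          ENNReal.ofReal_mul (Nat.cast_nonneg _), ENNReal.ofReal_natCast]

theorem IIDRollouts.measure_exists_notMem_ball_le (h : IIDRollouts P μ X Y x y) {r b : ℝ}
    (hb : P {ω | ∃ t, X t ω ∉ Metric.closedBall (0 : Vec nx) r} ≤ ENNReal.ofReal b) :
    μ {ω | ∃ i t, x i t ω ∉ Metric.closedBall (0 : Vec nx) r} ≤ ENNReal.ofReal (N * b) := by
  have hS : MeasurableSet {z : Fin T → Vec nx × Vec ny |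
      ∃ t, (z t).1 ∉ Metric.closedBall (0 : Vec nx) r} := by
    have hU : {z : Fin T → Vec nx × Vec ny | ∃ t, (z t).1 ∉ Metric.closedBall (0 : Vec nx) r}
        = ⋃ t, (fun z : Fin T → Vec nx × Vec ny => (z t).1) ⁻¹'
          (Metric.closedBall (0 : Vec nx) r)ᶜ := by
      ext; simp
    rw [hU]
    exact MeasurableSet.iUnion fun t =>
      (measurable_pi_apply t).fst Metric.isClosed_closedBall.measurableSet.compl
  exact measure_exists_rollout_mem_le h.ident hS hb

theorem IIDRollouts.measure_exists_noise_gt_le (h : IIDRollouts P μ X Y x y)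
    {fstar : Vec nx → Vec ny} (hfs : Measurable fstar)
    (hY : ∀ t ω, Y t ω = fstar (X t ω) + V t ω) {s b : ℝ}
    (hb : ∀ t, P {ω | s < ‖V t ω‖} ≤ ENNReal.ofReal b) :
    μ {ω | ∃ i t, s < ‖y i t ω - fstar (x i t ω)‖} ≤ ENNReal.ofReal (N * (T * b)) := by
  have hU : {z : Fin T → Vec nx × Vec ny | ∃ t, s < ‖(z t).2 - fstar (z t).1‖}
      = ⋃ t, {z : Fin T → Vec nx × Vec ny | s < ‖(z t).2 - fstar (z t).1‖} := by
    ext; simp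
  have hS : MeasurableSet {z : Fin T → Vec nx × Vec ny | ∃ t, s < ‖(z t).2 - fstar (z t).1‖} := by
    rw [hU]
    exact MeasurableSet.iUnion fun t => measurableSet_lt measurable_const
      ((measurable_pi_apply t).snd.sub (hfs.comp (measurable_pi_apply t).fst)).norm
  refine measure_exists_rollout_mem_le h.ident hS ?_
  have hV : {ω | (fun t => (X t ω, Y t ω)) ∈
      {z : Fin T → Vec nx × Vec ny | ∃ t, s < ‖(z t).2 - fstar (z t).1‖}}
      = ⋃ t, {ω | s < ‖V t ω‖} := by
    ext ω
    simp [hY]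
  rw [hV]
  refine (measure_iUnion_le _).trans ?_
  rw [tsum_fintype]
  refine (Finset.sum_le_sum fun t _ => hb t).trans_eq ?_
  rw [Finset.sum_const, Finset.card_univ, Fintype.card_fin, nsmul_eq_mul,
    ENNReal.ofReal_mul (Nat.cast_nonneg _), ENNReal.ofReal_natCast]

/-- With high probability the empirical second moment is at least half of its mean. -/
theorem IIDRollouts.measure_empirical_le_half_le [IsProbabilityMeasure P]
    (h : IIDRollouts P μ X Y x y) (hx : ∀ i t, Measurable (x i t))
    (hy : ∀ i t, Measurable (y i t)) {G : Vec nx → Vec ny} (hG : Measurable G) {κ : ℝ}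
    (hκ : 0 < κ) (hhyp : ∀ t, HypercontractiveWith P (fun ω => ‖G (X t ω)‖ ^ 2) κ) :
    μ {ω | 0 < ∑ t, ∫ ω, ‖G (X t ω)‖ ^ 2 ∂P ∧
        ∑ i, ∑ t, ‖G (x i t ω)‖ ^ 2 ≤ N * (∑ t, ∫ ω, ‖G (X t ω)‖ ^ 2 ∂P) / 2}
      ≤ ENNReal.ofReal (Real.exp (-(N / (8 * κ ^ 2)))) := by
  set M := ∑ t, ∫ ω, ‖G (X t ω)‖ ^ 2 ∂P with hM
  by_cases hM0 : 0 < M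
  · have hs := HypercontractiveWith.sum (fun t ω => by positivity) hhyp
    have hMi : ∫ ω, ∑ t, ‖G (X t ω)‖ ^ 2 ∂P = M :=
      integral_finsetSum _ fun t _ => (hhyp t).integrable
    have hsq := hs.integral_sq_le
    rw [hMi] at hsq
    simp only [hM0, true_and]
    exact measure_sum_rollouts_le_half_mean h.indep h.ident
      (fun i => measurable_pi_lambda _ fun t => (hx i t).prodMk (hy i t))
      (F := fun z => ∑ t, ‖G (z t).1‖ ^ 2)
      (Finset.measurable_fun_sum _ fun t _ =>
        ((hG.comp (measurable_pi_apply t).fst).norm.pow_const 2))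
      (fun z => by positivity) hs.integrable hs.integrable_sq hMi hM0 hκ hsq
  · simp [hM0]

/-- Offset deviation bound for the noise in a fixed direction. -/
theorem IIDRollouts.measure_offset_noise_ge_le [IsProbabilityMeasure P]
    (h : IIDRollouts P μ X Y x y) (hx : ∀ i t, Measurable (x i t))
    (hy : ∀ i t, Measurable (y i t)) (hX : ∀ t, Measurable (X t)) (hV : ∀ t, Measurable (V t))
    {fstar : Vec nx → Vec ny} (hfs : Measurable fstar)
    (hY : ∀ t ω, Y t ω = fstar (X t ω) + V t ω) {σ : ℝ} (hsub : CondSubGaussianNoise P X V σ)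
    {G : Vec nx → Vec ny} (hG : Measurable G) (u : ℝ) :
    μ {ω | u ≤ ∑ i, ∑ t, (inner ℝ (G (x i t ω)) (y i t ω - fstar (x i t ω))
        - σ ^ 2 * ‖G (x i t ω)‖ ^ 2 / 2)} ≤ ENNReal.ofReal (Real.exp (-u)) := by
  have h1 := measure_sum_rollouts_ge (b := 0) (u := u) h.indep h.ident
      (fun i => measurable_pi_lambda _ fun t => (hx i t).prodMk (hy i t))
      (F := fun z => ∑ t, (inner ℝ (G (z t).1) ((z t).2 - fstar (z t).1)
        - σ ^ 2 * ‖G (z t).1‖ ^ 2 / 2))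
      (Finset.measurable_fun_sum _ fun t _ => by
        have e1 : Measurable fun z : Fin T → Vec nx × Vec ny => G (z t).1 :=
          hG.comp (measurable_pi_apply t).fst
        have e2 : Measurable fun z : Fin T → Vec nx × Vec ny => (z t).2 - fstar (z t).1 :=
          (measurable_pi_apply t).snd.sub (hfs.comp (measurable_pi_apply t).fst)
        exact (e1.inner e2).sub (((e1.norm.pow_const 2).const_mul _).div_const _))
      (by
        have := lintegral_exp_sum_inner_noise_le_one hX hV hsub hG
        simpa [hY] using this)
  simpa using h1

theorem popErrorSq_eq_ofReal {g h : Vec nx → Vec ny} (hT : 0 < T)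
    (hi : ∀ t, Integrable (fun ω => ‖g (X t ω) - h (X t ω)‖ ^ 2) P) :
    popErrorSq P X g h
      = ENNReal.ofReal ((∑ t, ∫ ω, ‖g (X t ω) - h (X t ω)‖ ^ 2 ∂P) / T) := by
  have hT' : (0 : ℝ) < T := by exact_mod_cast hT
  rw [popErrorSq, ENNReal.ofReal_div_of_pos hT', ENNReal.ofReal_natCast,
    ENNReal.ofReal_sum_of_nonneg fun t _ => integral_nonneg fun ω => by positivity]
  congr 1
  refine Finset.sum_congr rfl fun t _ => ?_
  rw [ofReal_integral_eq_lintegral_ofReal (hi t) (Filter.Eventually.of_forall fun ω => by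
    simp only [Pi.zero_apply]; positivity)]
  refine lintegral_congr fun ω => ?_
  rw [ENNReal.ofReal_pow (norm_nonneg _), ofReal_norm]

theorem measure_biUnion_finset_le_card {C : Finset Θ} {S : Θ → Set Ω} {q b : ℝ}
    (hS : ∀ θ ∈ C, μ (S θ) ≤ ENNReal.ofReal b) (hb : 0 ≤ b) (hC : (C.card : ℝ) ≤ q) :
    μ (⋃ θ ∈ C, S θ) ≤ ENNReal.ofReal (q * b) := by
  refine (measure_biUnion_finset_le _ _).trans ((Finset.sum_le_sum hS).trans ?_)
  rw [Finset.sum_const, nsmul_eq_mul, ← ENNReal.ofReal_natCast,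
    ← ENNReal.ofReal_mul (Nat.cast_nonneg _)]
  exact ENNReal.ofReal_le_ofReal (mul_le_mul_of_nonneg_right hC hb)

end Events

/-! ### From the empirical to the population error -/

section Risk

variable {Ω₀ Θ : Type*} [MeasurableSpace Ω₀] {P : Measure Ω₀} [IsProbabilityMeasure P]
  {nx ny T N : ℕ} {X : Fin T → Ω₀ → Vec nx}

/-- On data for which the empirical quantities behave, regularized empirical risk minimizers have
small population error. -/
theorem IsRegERM.sum_integral_le {f : Θ → Vec nx → Vec ny} {fstar : Vec nx → Vec ny}
    {Reg : (Vec nx → Vec ny) → ℝ} {lam : ℝ} (hlam : 0 ≤ lam) (hReg : ∀ g, 0 ≤ Reg g)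
    (hstar : ∃ θ, f θ = fstar) {x : Fin N → Fin T → Vec nx} {y : Fin N → Fin T → Vec ny}
    {θ θ' : Θ} (hθ : IsRegERM lam Reg f x y θ) (hN : 0 < N) (hT : 0 < T)
    {r s η σ u κ : ℝ} (hσ : 0 < σ) (hκ : 0 < κ)
    (hX : ∀ t, Measurable (X t))
    (hhyp : ∀ θ t, HypercontractiveWith P (fun ω => ‖f θ (X t ω) - fstar (X t ω)‖ ^ 2) κ)
    (hclose : ∀ z ∈ Metric.closedBall (0 : Vec nx) r, ‖f θ z - f θ' z‖ ≤ η)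
    (hsη : s * η ≤ σ ^ 2 / (N * T)) (hη2 : η ^ 2 ≤ σ ^ 2 / (N * T))
    (hPr : κ ^ 2 * P.real {ω | ∃ t, X t ω ∉ Metric.closedBall (0 : Vec nx) r} ≤ 1 / 64)
    (hxr : ∀ i t, x i t ∈ Metric.closedBall (0 : Vec nx) r)
    (hys : ∀ i t, ‖y i t - fstar (x i t)‖ ≤ s)
    (hlow : 0 < ∑ t, ∫ ω, ‖f θ' (X t ω) - fstar (X t ω)‖ ^ 2 ∂P →
      N * (∑ t, ∫ ω, ‖f θ' (X t ω) - fstar (X t ω)‖ ^ 2 ∂P) / 2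
        < ∑ i, ∑ t, ‖f θ' (x i t) - fstar (x i t)‖ ^ 2)
    (hdev : ∑ i, ∑ t, (inner ℝ ((8 * σ ^ 2)⁻¹ • (f θ' (x i t) - fstar (x i t)))
        (y i t - fstar (x i t))
        - σ ^ 2 * ‖(8 * σ ^ 2)⁻¹ • (f θ' (x i t) - fstar (x i t))‖ ^ 2 / 2) < u) :
    (∑ t, ∫ ω, ‖f θ (X t ω) - fstar (X t ω)‖ ^ 2 ∂P) / T
      ≤ 54 * (u + 1) * (σ ^ 2 / (N * T)) + 4 * lam * Reg fstar := by
  have hNR : (0 : ℝ) < N := by exact_mod_cast hN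
  have hTR : (0 : ℝ) < T := by exact_mod_cast hT
  have hn : (0 : ℝ) < N * T := mul_pos hNR hTR
  set v : Fin N × Fin T → Vec ny := fun p => y p.1 p.2 - fstar (x p.1 p.2) with hv
  set g : Fin N × Fin T → Vec ny := fun p => f θ (x p.1 p.2) - fstar (x p.1 p.2) with hg
  set g' : Fin N × Fin T → Vec ny := fun p => f θ' (x p.1 p.2) - fstar (x p.1 p.2) with hg'
  have hbasic : 1 / ((N : ℝ) * T) * ∑ p, ‖v p - g p‖ ^ 2 + lam * Reg (f θ)
      ≤ 1 / ((N : ℝ) * T) * ∑ p, ‖v p‖ ^ 2 + lam * Reg fstar := by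
    obtain ⟨θ₀, hθ₀⟩ := hstar
    have := hθ θ₀
    rw [hθ₀] at this
    simp only [regEmpRisk] at this
    simpa [Fintype.sum_prod_type, hv, hg] using this
  -- The scale `(8σ²)⁻¹` turns the offset `σ² ‖·‖² / 2` into `1/16` of `‖g'‖²` once multiplied back
  -- by `8σ²`.
  have hdev' : ∑ p, inner ℝ (v p) (g' p) ≤ 1 / 16 * ∑ p, ‖g' p‖ ^ 2 + 8 * σ ^ 2 * u := by
    have e : ∀ p, inner ℝ ((8 * σ ^ 2)⁻¹ • g' p) (v p) - σ ^ 2 * ‖(8 * σ ^ 2)⁻¹ • g' p‖ ^ 2 / 2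
        = (8 * σ ^ 2)⁻¹ * (inner ℝ (v p) (g' p) - 1 / 16 * ‖g' p‖ ^ 2) := by
      intro p
      rw [real_inner_smul_left, real_inner_comm, norm_smul, Real.norm_of_nonneg (by positivity)]
      field_simp
      ring
    have h1 : ∑ p, (8 * σ ^ 2)⁻¹ * (inner ℝ (v p) (g' p) - 1 / 16 * ‖g' p‖ ^ 2) < u := by
      simp_rw [← e]
      simpa [Fintype.sum_prod_type, hv, hg'] using hdev
    rw [← Finset.mul_sum, inv_mul_lt_iff₀ (by positivity), Finset.sum_sub_distrib,
      ← Finset.mul_sum] at h1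
    linarith
  have hS := sum_norm_sq_le_of_basic (n := N * T) (by simp) hn
    (mul_nonneg hlam (hReg _)) hbasic (fun p => hys p.1 p.2)
    (fun p => by simpa [hg, hg'] using hclose _ (hxr p.1 p.2)) hsη hη2 hdev'
  set S' := ∑ p, ‖g' p‖ ^ 2 with hS'
  set M' := ∑ t, ∫ ω, ‖f θ' (X t ω) - fstar (X t ω)‖ ^ 2 ∂P with hM'
  have hM'S : N * M' ≤ 2 * S' := by
    by_cases h0 : 0 < M'
    · have h1 := hlow h0
      have h2 : S' = ∑ i, ∑ t, ‖f θ' (x i t) - fstar (x i t)‖ ^ 2 := by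
        simp [hS', hg', Fintype.sum_prod_type]
      linarith
    · have h1 : 0 ≤ S' := by positivity
      have h2 := mul_nonneg hNR.le (sub_nonneg.2 (not_lt.1 h0))
      linarith
  have hmeas : MeasurableSet {ω | ∃ t, X t ω ∉ Metric.closedBall (0 : Vec nx) r} := by
    have hU : {ω | ∃ t, X t ω ∉ Metric.closedBall (0 : Vec nx) r}
        = ⋃ t, X t ⁻¹' (Metric.closedBall (0 : Vec nx) r)ᶜ := by
      ext; simp
    rw [hU]
    exact MeasurableSet.iUnion fun t => hX t Metric.isClosed_closedBall.measurableSet.compl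
  have hcomp : ∀ t, 7 / 8 * ∫ ω, ‖f θ (X t ω) - fstar (X t ω)‖ ^ 2 ∂P
      ≤ 9 / 8 * ∫ ω, ‖f θ' (X t ω) - fstar (X t ω)‖ ^ 2 ∂P + 9 * (σ ^ 2 / (N * T)) := by
    intro t
    refine (hhyp θ t).integral_le_of_close (fun ω => by positivity) hκ (fun ω => by positivity)
      (hhyp θ' t).integrable hmeas hPr (by positivity) fun ω hω => ?_
    have hb : X t ω ∈ Metric.closedBall (0 : Vec nx) r := by
      by_contra hcon
      exact hω ⟨t, hcon⟩
    have e1 : ‖f θ (X t ω) - fstar (X t ω)‖ ≤ ‖f θ' (X t ω) - fstar (X t ω)‖ + η := by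
      have h3 := hclose _ hb
      have h4 : ‖f θ (X t ω) - fstar (X t ω)‖
          ≤ ‖f θ (X t ω) - f θ' (X t ω)‖ + ‖f θ' (X t ω) - fstar (X t ω)‖ :=
        norm_sub_le_norm_sub_add_norm_sub _ _ _
      linarith
    have e2 := pow_le_pow_left₀ (norm_nonneg _) e1 2
    nlinarith [sq_nonneg (‖f θ' (X t ω) - fstar (X t ω)‖ - 8 * η)]
  have hsum := Finset.sum_le_sum fun t (_ : t ∈ Finset.univ) => hcomp t
  rw [Finset.sum_add_distrib, ← Finset.mul_sum, ← Finset.mul_sum, Finset.sum_const,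
    Finset.card_univ, Fintype.card_fin, nsmul_eq_mul, ← hM'] at hsum
  set M := ∑ t, ∫ ω, ‖f θ (X t ω) - fstar (X t ω)‖ ^ 2 ∂P with hM
  have hσn : (N : ℝ) * (T * (9 * (σ ^ 2 / (N * T)))) = 9 * σ ^ 2 := by field_simp
  have hNM : 7 / 8 * (N * M) ≤ 9 / 4 * S' + 9 * σ ^ 2 := by
    have := mul_le_mul_of_nonneg_left hsum hNR.le
    rw [mul_add, hσn] at this
    linarith
  -- No sign of `u` is assumed; `S' ≥ 0` gives the lower bound on `u` needed to round
  -- `(8/7)(9/4)(72/55) · 16` up to `54`. The penalty factor `(8/7)(9/4)(72/55)` is rounded up to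
  -- `4`.
  have hu0 : 0 ≤ 72 / 55 * (16 * σ ^ 2 * u) + 27 * σ ^ 2 + 72 / 55 * (N * T * (lam * Reg fstar))
      := by
    have : 0 ≤ S' := by positivity
    linarith [sq_nonneg σ]
  have hfinal : N * M ≤ 54 * (u + 1) * σ ^ 2 + N * T * (4 * lam * Reg fstar) := by
    have hl : 0 ≤ N * T * (lam * Reg fstar) := mul_nonneg hn.le (mul_nonneg hlam (hReg _))
    linarith [sq_nonneg σ]
  rw [div_le_iff₀ hTR]
  have h6 : N * ((54 * (u + 1) * (σ ^ 2 / (N * T)) + 4 * lam * Reg fstar) * T)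
      = 54 * (u + 1) * σ ^ 2 + N * T * (4 * lam * Reg fstar) := by
    field_simp
  rw [← h6] at hfinal
  exact le_of_mul_le_mul_left hfinal hNR

end Risk

/-! ### Assembly of the high-probability bound -/

theorem mainTheorem5 (ny : ℕ) (r₁ r₂ K A : ℝ) (hr₁ : 0 ≤ r₁) (hr₂ : 0 ≤ r₂) (hK : 0 < K)
    (hA : 0 < A) (p₁ p₂ : Polynomial ℝ) :
    ∃ C c α : ℝ, 0 < C ∧ 0 < c ∧ 0 < α ∧
      ∀ (nx T N : ℕ) (σ dim lam δ : ℝ),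
        2 ≤ N * T → 0 < σ → 1 ≤ dim → 0 ≤ lam → 0 < δ → δ ≤ 1 →
      ∀ (Θ : Type*) [PseudoMetricSpace Θ] (f : Θ → Vec nx → Vec ny) (fstar : Vec nx → Vec ny),
        (∀ θ, Measurable (f θ)) → (∃ θ, f θ = fstar) → RegularClass f fstar r₂ A dim p₁ p₂ →
      ∀ Reg : (Vec nx → Vec ny) → ℝ, (∀ g, 0 ≤ Reg g) →
      ∀ (Ω₀ : Type*) [MeasurableSpace Ω₀] (P : Measure Ω₀) [IsProbabilityMeasure P]
        (X : Fin T → Ω₀ → Vec nx) (V Y : Fin T → Ω₀ → Vec ny),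
        (∀ t, Measurable (X t)) → (∀ t, Measurable (V t)) →
        (∀ t ω, Y t ω = fstar (X t ω) + V t ω) →
        TrajectoryTail P X σ r₁ K → CondSubGaussianNoise P X V σ →
      ∀ (Ω : Type*) [MeasurableSpace Ω] (μ : Measure Ω) [IsProbabilityMeasure μ]
        (x : Fin N → Fin T → Ω → Vec nx) (y : Fin N → Fin T → Ω → Vec ny),
        (∀ i t, Measurable (x i t)) → (∀ i t, Measurable (y i t)) →
        IIDRollouts P μ X Y x y →
        ENNReal.ofReal (c * (1 + |Real.log σ|)) * condNumber P X f fstar ^ 2 *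
            ENNReal.ofReal (dim + Real.log (1 / δ))
          ≤ ENNReal.ofReal ((N : ℝ) / Real.log ((N : ℝ) * T)) →
        μ {ω | ∃ θhat : Θ,
            IsRegERM lam Reg f (fun i t => x i t ω) (fun i t => y i t ω) θhat ∧
            ENNReal.ofReal
              (C * ((1 + |Real.log σ|) * Real.log ((N : ℝ) * T)) ^ α *
                  (σ ^ 2 * (dim + Real.log (1 / δ)) / ((N : ℝ) * T)) + 4 * lam * Reg fstar)
              < popErrorSq P X (f θhat) fstar}
          ≤ ENNReal.ofReal δ := by
  obtain ⟨C, c, hC, hc, hscales⟩ := exists_scales ny r₁ r₂ K A hr₁ hr₂ hK hA p₁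
  refine ⟨C, c, 1, hC, hc, one_pos, ?_⟩
  intro nx T N σ dim lam δ hNT hσ hdim hlam hδ hδ1 Θ _ f fstar hf hstar hreg Reg hReg Ω₀ _ P _
    X V Y hX hV hY htail hsub Ω _ μ _ x y hx hy hroll hcond
  have hfs : Measurable fstar := by
    obtain ⟨θ₀, hθ₀⟩ := hstar
    exact hθ₀ ▸ hf θ₀
  have hN : 0 < N := Nat.pos_of_ne_zero (by rintro rfl; simp at hNT)
  have hT : 0 < T := Nat.pos_of_ne_zero (by rintro rfl; simp at hNT)
  have hlδ : 0 ≤ Real.log (1 / δ) := Real.log_nonneg (by rw [le_div_iff₀ hδ]; linarith)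
  have hD : 0 < dim + Real.log (1 / δ) := by linarith
  have hcσ : 0 < c * (1 + |Real.log σ|) := by positivity
  have hNTR : (2 : ℝ) ≤ (N : ℝ) * T := by exact_mod_cast hNT
  have hlog : 0 < Real.log ((N : ℝ) * T) := Real.log_pos (by linarith)
  -- An infinite condition number would make the left side of the sample-size condition infinite,
  -- its other factors being positive.
  have htop : condNumber P X f fstar ≠ ⊤ := by
    intro htop
    rw [htop, ENNReal.top_pow two_ne_zero, ENNReal.mul_top (ENNReal.ofReal_pos.2 hcσ).ne',
      ENNReal.top_mul (ENNReal.ofReal_pos.2 hD).ne'] at hcond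
    exact ENNReal.ofReal_ne_top (top_le_iff.1 hcond)
  set κ := (condNumber P X f fstar).toReal with hκ
  have hcond' : c * (1 + |Real.log σ|) * κ ^ 2 * (dim + Real.log (1 / δ))
      ≤ N / Real.log (N * T : ℕ) := by
    rw [← ENNReal.ofReal_toReal htop, ← hκ, ← ENNReal.ofReal_pow ENNReal.toReal_nonneg,
      ← ENNReal.ofReal_mul hcσ.le, ← ENNReal.ofReal_mul (by positivity),
      ENNReal.ofReal_le_ofReal_iff (by positivity)] at hcond
    exact_mod_cast hcond
  have hhyp : ∀ θ t, HypercontractiveWith P (fun ω => ‖f θ (X t ω) - fstar (X t ω)‖ ^ 2) κ :=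
    fun θ t => hypercontractiveWith_of_condNumber θ t (hX t) (hf θ) hfs
      (lintegral_enorm_sq_ne_top (G := fun z => f θ z - fstar z) hX hσ hr₁ hr₂ htail
        (fun r hr z hz => hreg.bounded r hr θ z hz) t) htop
  have hpop : ∀ θ, popErrorSq P X (f θ) fstar
      = ENNReal.ofReal ((∑ t, ∫ ω, ‖f θ (X t ω) - fstar (X t ω)‖ ^ 2 ∂P) / T) :=
    fun θ => popErrorSq_eq_ofReal hT fun t => (hhyp θ t).integrable
  -- If all mean errors vanish, the population error is zero and the bad event is empty. Otherwise
  -- some nonzero mean forces `κ ≥ 1`, as the choice of scales requires.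
  by_cases hall : ∀ θ t, ∫ ω, ‖f θ (X t ω) - fstar (X t ω)‖ ^ 2 ∂P = 0
  · simp [hpop, hall]
  push Not at hall
  obtain ⟨θ₁, t₁, hne⟩ := hall
  have hκ1 : 1 ≤ κ := (hhyp θ₁ t₁).one_le ENNReal.toReal_nonneg hne
  have hκ0 : 0 < κ := by linarith
  obtain ⟨r, a, ε, u, hr1, hr2, hε, hε1, ha, hsη, hη2, hball, hκball, hnoise, hlow, hdev, hfin⟩ :=
    hscales N (N * T) σ dim δ κ hNT (Nat.le_mul_of_pos_right N hT) hN hσ hdim hδ hδ1 hκ1 hcond'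
  push_cast at hsη hη2 hnoise hfin
  obtain ⟨net, hcard, hnet⟩ := hreg.exists_finset_net hA hε hε1
  have hout := htail r hr1
  set B₁ := {ω | ∃ i t, x i t ω ∉ Metric.closedBall (0 : Vec nx) r} with hB₁
  set B₂ := {ω | ∃ i t, σ * ny * a < ‖y i t ω - fstar (x i t ω)‖} with hB₂
  let low : Θ → Set Ω := fun θ => {ω | 0 < ∑ t, ∫ ω, ‖f θ (X t ω) - fstar (X t ω)‖ ^ 2 ∂P ∧
    ∑ i, ∑ t, ‖f θ (x i t ω) - fstar (x i t ω)‖ ^ 2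
      ≤ N * (∑ t, ∫ ω, ‖f θ (X t ω) - fstar (X t ω)‖ ^ 2 ∂P) / 2}
  let dev : Θ → Set Ω := fun θ => {ω | u ≤ ∑ i, ∑ t,
    (inner ℝ ((8 * σ ^ 2)⁻¹ • (f θ (x i t ω) - fstar (x i t ω))) (y i t ω - fstar (x i t ω))
      - σ ^ 2 * ‖(8 * σ ^ 2)⁻¹ • (f θ (x i t ω) - fstar (x i t ω))‖ ^ 2 / 2)}
  have hμ₁ : μ B₁ ≤ ENNReal.ofReal (δ / 4) :=
    (hroll.measure_exists_notMem_ball_le hout).trans (ENNReal.ofReal_le_ofReal hball)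
  have hμ₂ : μ B₂ ≤ ENNReal.ofReal (δ / 4) := by
    refine (hroll.measure_exists_noise_gt_le hfs hY
      (measure_norm_noise_ge hσ hX hV hsub · a)).trans (ENNReal.ofReal_le_ofReal ?_)
    linarith
  have hμ₃ : μ (⋃ θ ∈ net, low θ) ≤ ENNReal.ofReal (δ / 4) :=
    (measure_biUnion_finset_le_card (fun θ _ => hroll.measure_empirical_le_half_le hx hy
      (G := fun z => f θ z - fstar z)
      ((hf θ).sub hfs) hκ0 (hhyp θ)) (Real.exp_pos _).le hcard).trans
      (ENNReal.ofReal_le_ofReal hlow)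
  have hG : ∀ θ, Measurable fun z => (8 * σ ^ 2)⁻¹ • (f θ z - fstar z) := fun θ =>
    ((hf θ).sub hfs).const_smul (8 * σ ^ 2)⁻¹
  have hμ₄ : μ (⋃ θ ∈ net, dev θ) ≤ ENNReal.ofReal (δ / 4) :=
    (measure_biUnion_finset_le_card (fun θ _ => hroll.measure_offset_noise_ge_le hx hy hX hV hfs
      hY hsub (G := fun z => (8 * σ ^ 2)⁻¹ • (f θ z - fstar z)) (hG θ) u) (Real.exp_pos _).le hcard).trans
      (ENNReal.ofReal_le_ofReal hdev)
  have hPr : κ ^ 2 * P.real {ω | ∃ t, X t ω ∉ Metric.closedBall (0 : Vec nx) r} ≤ 1 / 64 := by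
    refine le_trans (mul_le_mul_of_nonneg_left ?_ (sq_nonneg κ)) hκball
    exact ENNReal.toReal_le_of_le_ofReal (by positivity) hout
  -- Outside the four events, each minimizer is compared with its own nearest net point. The bad set
  -- itself need not be measurable, since only monotonicity of `μ` is used.
  have hsubset : {ω | ∃ θhat : Θ,
      IsRegERM lam Reg f (fun i t => x i t ω) (fun i t => y i t ω) θhat ∧
      ENNReal.ofReal
        (C * ((1 + |Real.log σ|) * Real.log ((N : ℝ) * T)) ^ (1 : ℝ) *
            (σ ^ 2 * (dim + Real.log (1 / δ)) / ((N : ℝ) * T)) + 4 * lam * Reg fstar)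
        < popErrorSq P X (f θhat) fstar}
      ⊆ (B₁ ∪ B₂) ∪ ((⋃ θ ∈ net, low θ) ∪ ⋃ θ ∈ net, dev θ) := by
    rintro ω ⟨θ, herm, hlt⟩
    by_contra hgood
    simp only [Set.mem_union, not_or, Set.mem_iUnion, not_exists] at hgood
    obtain ⟨⟨hg₁, hg₂⟩, hg₃, hg₄⟩ := hgood
    obtain ⟨θ', hθ', hdist⟩ := hnet θ
    have hlow' := hg₃ θ' hθ'
    have hdev' := hg₄ θ' hθ'
    simp only [hB₁, hB₂, low, dev, Set.mem_ofPred_eq, not_exists, not_not, not_and, not_le, not_lt]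
      at hg₁ hg₂ hlow' hdev'
    have hbound := herm.sum_integral_le hlam hReg hstar hN hT hσ hκ0 hX hhyp
      (fun z hz => (hreg.lipschitz r hr2 θ θ' z hz).trans
        (mul_le_mul (le_abs_self _) hdist dist_nonneg (abs_nonneg _)))
      hsη hη2 hPr hg₁ hg₂ hlow' hdev'
    rw [hpop, Real.rpow_one] at hlt
    refine absurd hlt (not_lt.2 (ENNReal.ofReal_le_ofReal (hbound.trans ?_)))
    have h1 := mul_le_mul_of_nonneg_right hfin
      (by positivity : 0 ≤ σ ^ 2 / ((N : ℝ) * T))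
    refine add_le_add_left (h1.trans_eq ?_) _
    ring
  calc _ ≤ μ ((B₁ ∪ B₂) ∪ ((⋃ θ ∈ net, low θ) ∪ ⋃ θ ∈ net, dev θ)) := measure_mono hsubset
    _ ≤ (ENNReal.ofReal (δ / 4) + ENNReal.ofReal (δ / 4))
        + (ENNReal.ofReal (δ / 4) + ENNReal.ofReal (δ / 4)) :=
        (measure_union_le _ _).trans (add_le_add
          ((measure_union_le _ _).trans (add_le_add hμ₁ hμ₂))
          ((measure_union_le _ _).trans (add_le_add hμ₃ hμ₄)))
    _ = ENNReal.ofReal δ := by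
        rw [← ENNReal.ofReal_add (by positivity) (by positivity),
          ← ENNReal.ofReal_add (by positivity) (by positivity)]
        congr 1
        ring
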